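/- Let $(X,d)$ be a nonempty complete metric space with a Borel regular outer measure $\mu$ such that $0<\mu(B)<\infty$ for every ball $B$, and let $c_D>1$ be such that $\mu(B(x,2r))\le c_D\,\mu(B(y,r))$ for all $x,y\in X$ and $r>0$ with $B(x,2r)\cap B(y,r)\neq\emptyset$, where $B(x,r)=\{y\in X: d(x,y)<r\}$. For a locally integrable $f\colon X\to\mathbb R$ let $f_B=\mu(B)^{-1}\int_B f\,d\mu$ and $\|f\|_*=\sup_B \mu(B)^{-1}\int_B|f-f_B|\,d\mu$, and let $BMO(X)$ be the set of such $f$ with $\|f\|_*<\infty$. Here and below suprema over $B$ run over all balls $B=B(x,r)$, $x\in X$, $r>0$. For $E_1,E_2\subset X$ put $$S(E_1,E_2)=\sup_B\min_{k=1,2}\frac{\mu(E_k\cap B)}{\mu(B)}.$$ Let $F\colon X\to X$ be $\mu$-measurable. Call $F$ a BMO-map if $\mu(F^{-1}(E))=0$ whenever $\mu(E)=0$, and $C_F(f)=f\circ F\in BMO(X)$ for every $f\in BMO(X)$. Let $\|C_F\|\in[0,\infty]$ be the least $M$ with $\|f\circ F\|_*\le M\|f\|_*$ for all $f\in BMO(X)$.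 The following conditions are equivalent: (i) there are constants $0<K,\alpha<\infty$ such that $S(F^{-1}(E_1),F^{-1}(E_2))\le K\,S(E_1,E_2)^{\alpha}$ for all $\mu$-measurable sets $E_1,E_2\subset X$; (ii) there are constants $0<\gamma<1/(4c_D^3)$ and $\lambda>0$ such that $S(F^{-1}(E_1),F^{-1}(E_2))<\gamma$ for all $\mu$-measurable sets $E_1,E_2\subset X$ with $S(E_1,E_2)<\lambda$; (iii) $F$ is a BMO-map. Moreover: (a) If (i) holds with constants $K,\alpha$, then $F$ is a BMO-map and $\|C_F\|\le CK/\alpha$, where $C$ depends only on $c_D$. (b) If (ii) holds with constants $\gamma,\lambda$, then $F$ is a BMO-map and $\|C_F\|\le C\,(1+\log(1/\lambda))$, where $C$ depends only on $c_D$ and $\gamma$ (condition (ii) forces $\lambda\le1$). (c) There are positive constants $K,\beta$, depending only on $c_D$, such that every BMO-map $F$ satisfies $\|C_F\|<\infty$ and (i) holds with this $K$ and with every $\alpha>0$ such that $\alpha\|C_F\|\le\beta$; in particular with $\alpha=\beta/\|C_F\|$ if $\|C_F\|>0$. -/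

import Mathlib

open MeasureTheory Metric
open scoped ENNReal

universe u

/-- The doubling condition with constant `c`: all balls have positive finite measure, and
`μ (B(x, 2r)) ≤ c μ (B(y, r))` whenever `B(x, 2r)` meets `B(y, r)`. -/
structure IsDoublingMeasure {X : Type u} [MetricSpace X] [MeasurableSpace X]
    (c : ℝ) (μ : Measure X) : Prop where
  ball_pos : ∀ (x : X) (r : ℝ), 0 < r → 0 < μ (ball x r)
  ball_lt_top : ∀ (x : X) (r : ℝ), 0 < r → μ (ball x r) < ∞
  doubling : ∀ (x y : X) (r : ℝ), 0 < r → (ball x (2 * r) ∩ ball y r).Nonempty →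
    μ (ball x (2 * r)) ≤ ENNReal.ofReal c * μ (ball y r)

/-- The BMO seminorm `‖f‖_*`, the supremum over all balls of the mean oscillation. -/
noncomputable def bmoNorm {X : Type u} [MetricSpace X] [MeasurableSpace X]
    (μ : Measure X) (f : X → ℝ) : ℝ≥0∞ :=
  ⨆ (x : X) (r : ℝ) (_ : 0 < r),
    (∫⁻ y in ball x r, ‖f y - ⨍ z in ball x r, f z ∂μ‖ₑ ∂μ) / μ (ball x r)

/-- `f ∈ BMO(X)`: locally integrable with finite BMO seminorm. -/
def MemBMO {X : Type u} [MetricSpace X] [MeasurableSpace X]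
    (μ : Measure X) (f : X → ℝ) : Prop :=
  LocallyIntegrable f μ ∧ bmoNorm μ f < ∞

/-- The two defining properties of a BMO-map (for a `μ`-measurable `F`). -/
structure IsBMOMap {X : Type u} [MetricSpace X] [MeasurableSpace X]
    (μ : Measure X) (F : X → X) : Prop where
  preimage_null : ∀ E : Set X, μ E = 0 → μ (F ⁻¹' E) = 0
  comp_mem : ∀ f : X → ℝ, MemBMO μ f → MemBMO μ (f ∘ F)

/-- The operator norm of `C_F : f ↦ f ∘ F` on `BMO(X)`: the least `M ∈ [0, ∞]` with
`‖f ∘ F‖_* ≤ M ‖f‖_*` for all `f ∈ BMO(X)`. -/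
noncomputable def compOpNorm {X : Type u} [MetricSpace X] [MeasurableSpace X]
    (μ : Measure X) (F : X → X) : ℝ≥0∞ :=
  sInf {M : ℝ≥0∞ | ∀ f : X → ℝ, MemBMO μ f → bmoNorm μ (f ∘ F) ≤ M * bmoNorm μ f}

/-- `sup_B min_{k = 1, 2} μ (E_k ∩ B) / μ (B)`, the supremum over all balls `B`. -/
noncomputable def supMinDensity {X : Type u} [MetricSpace X] [MeasurableSpace X]
    (μ : Measure X) (E₁ E₂ : Set X) : ℝ≥0∞ :=
  ⨆ (x : X) (r : ℝ) (_ : 0 < r),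
    min (μ (E₁ ∩ ball x r) / μ (ball x r)) (μ (E₂ ∩ ball x r) / μ (ball x r))

/-- The power-type estimate with constants `K` and `α`. `NullMeasurableSet E μ` says that `E` is
`μ`-measurable, that is, measurable for the completion of `μ`. -/
def PowerEstimate {X : Type u} [MetricSpace X] [MeasurableSpace X]
    (μ : Measure X) (F : X → X) (K α : ℝ) : Prop :=
  ∀ E₁ E₂ : Set X, NullMeasurableSet E₁ μ → NullMeasurableSet E₂ μ →
    supMinDensity μ (F ⁻¹' E₁) (F ⁻¹' E₂) ≤ ENNReal.ofReal K * supMinDensity μ E₁ E₂ ^ α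

/-- The threshold estimate with constants `γ` and `l`. -/
def ThresholdEstimate {X : Type u} [MetricSpace X] [MeasurableSpace X]
    (μ : Measure X) (F : X → X) (γ l : ℝ) : Prop :=
  ∀ E₁ E₂ : Set X, NullMeasurableSet E₁ μ → NullMeasurableSet E₂ μ →
    supMinDensity μ E₁ E₂ < ENNReal.ofReal l →
      supMinDensity μ (F ⁻¹' E₁) (F ⁻¹' E₂) < ENNReal.ofReal γ

/-!
The joint density `S(E₁, E₂)` of two sets and `BMO` determine each other, and a map acts on both.

* From `BMO` to densities: for `f ∈ BMO`, the joint density of `{f ≤ t}` and `{f ≥ t + T}` decays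
  exponentially in `T / ‖f‖_*`, by John–Nirenberg (`exists_supMinDensity_level_le`).
* From level sets to `BMO`: conversely, if at one fixed scale `s` the joint density of `{f < t}` and
  `{f > t + s}` is at most `γ < 1 / (4 c³)` for all `t`, then `‖f‖_* ≤ C(γ) s`, a theorem of John
  and Strömberg (`exists_bmoNorm_le_of_levelSetsSeparated`).
* From densities to `BMO`: if `S(E₁, E₂) ≤ σ < 1`, then some `f` with `‖f‖_* ≤ C / log (1 / σ)` is
  `≤ 0` almost everywhere on `E₁` and `≥ 1` almost everywhere on `E₂` (`exists_memBMO_separating`).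

The first two facts both come from an iteration (`HasOscillationBound.measure_superlevel_le`): if on
every ball `f` lies in an interval of length `s` outside a set of small relative measure, then on
each ball the superlevel sets decay geometrically. The iteration uses medians in place of means, so
that no integrability is needed to start it.

For the third fact, follow `x` through the balls `B(x, 2⁻ʲ)`, with `j` running from `-∞` to `∞`, and
let `a` and `b` be the logarithms of the densities of `E₂` and `E₁` relative to `σ`, replaced by
their envelopes of bounded rate of decay, which makes them comparable at neighbouring points. As the
two densities never exceed `σ` together, `a ≤ L - b` for `L ≈ log (1 / σ)`. The path which is pushed
up by the obstacle `a`, down by the obstacle `L - b`, and rests otherwise, ends at a value of at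
least `L` at density points of `E₂` and of at most `0` at density points of `E₁`. Below a given ball
it can move by `t` only where one of the densities increases by a factor `eᵗ`, which by the
weak-type maximal inequality happens on a part of the ball of size `O(e⁻ᵗ)`; so the endpoint is in
`BMO`.

Each of the two density estimates for `F` therefore gives a bound for `‖f ∘ F‖_*`, by applying it to
level sets of `f`. In the other direction, a `BMO`-map has finite norm by a Baire category argument
(`IsBMOMap.exists_bmoNorm_comp_le`), and John–Nirenberg for `f ∘ F`, where `f` separates `E₁` from
`E₂`, is the power-type estimate.
-/

/-! ### Doubling measures: density and covering -/

section Doubling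

open Filter Set Topology

variable {X : Type u} [MetricSpace X] [MeasurableSpace X] {c : ℝ} {μ : Measure X}

namespace IsDoublingMeasure

lemma measure_ball_le (h : IsDoublingMeasure c μ) (x : X) {r : ℝ} (hr : 0 < r) :
    μ (ball x (2 * r)) ≤ ENNReal.ofReal c * μ (ball x r) :=
  h.doubling x x r hr ⟨x, mem_ball_self (by positivity), mem_ball_self hr⟩

lemma measure_ball_four_le (h : IsDoublingMeasure c μ) (hc : 1 < c) (x : X) {r : ℝ} (hr : 0 < r) :
    μ (ball x (4 * r)) ≤ ENNReal.ofReal (c ^ 2) * μ (ball x r) := by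
  have h1 := h.measure_ball_le x (r := 2 * r) (by positivity)
  rw [show 2 * (2 * r) = 4 * r by ring] at h1
  refine h1.trans ((mul_le_mul_right (h.measure_ball_le x hr) _).trans_eq ?_)
  rw [← mul_assoc, ← ENNReal.ofReal_mul (by linarith), sq]

lemma ball_ne_zero (h : IsDoublingMeasure c μ) (x : X) {r : ℝ} (hr : 0 < r) : μ (ball x r) ≠ 0 :=
  (h.ball_pos x r hr).ne'

lemma ball_ne_top (h : IsDoublingMeasure c μ) (x : X) {r : ℝ} (hr : 0 < r) : μ (ball x r) ≠ ∞ :=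
  (h.ball_lt_top x r hr).ne

lemma isLocallyFiniteMeasure (h : IsDoublingMeasure c μ) : IsLocallyFiniteMeasure μ :=
  ⟨fun x => ⟨ball x 1, ball_mem_nhds x one_pos, h.ball_lt_top x 1 one_pos⟩⟩

lemma sigmaFinite (h : IsDoublingMeasure c μ) : SigmaFinite μ := by
  rcases isEmpty_or_nonempty X with hX | ⟨⟨x⟩⟩
  · rw [Measure.eq_zero_of_isEmpty μ]; infer_instance
  · exact ⟨⟨fun n : ℕ => ball x (n + 1), fun _ => trivial,
      fun n => h.ball_lt_top x _ (by positivity),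
      eq_univ_of_forall fun y => by
        obtain ⟨n, hn⟩ := exists_nat_gt (dist y x)
        exact mem_iUnion.2 ⟨n, mem_ball.2 (by linarith)⟩⟩⟩

lemma isUnifLocDoublingMeasure (h : IsDoublingMeasure c μ) (hc : 1 < c) :
    IsUnifLocDoublingMeasure μ := by
  refine ⟨⟨(c ^ 2).toNNReal, ?_⟩⟩
  filter_upwards [self_mem_nhdsWithin] with r hr x
  have hr : 0 < r := hr
  calc μ (closedBall x (2 * r)) ≤ μ (ball x (4 * r)) :=
        measure_mono (closedBall_subset_ball (by linarith))
    _ ≤ ENNReal.ofReal (c ^ 2) * μ (ball x r) := h.measure_ball_four_le hc x hr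
    _ ≤ _ := mul_le_mul_right (measure_mono ball_subset_closedBall) _

variable [BorelSpace X]

/-- A disjoint family of balls of fixed radius is countable, because the measure is `σ`-finite and
balls have positive measure; a maximal one is a countable net. -/
lemma secondCountableTopology (h : IsDoublingMeasure c μ) : SecondCountableTopology X := by
  have := h.sigmaFinite
  refine secondCountable_of_almost_dense_set fun ε hε => ?_
  obtain ⟨u, -, hu, hcov⟩ := Vitali.exists_disjoint_subfamily_covering_enlargement
    (fun x : X => ball x (ε / 2)) univ (fun _ => 0) 2 one_lt_two (by simp) 0 (by simp)
    (fun x _ => ⟨x, mem_ball_self (by positivity)⟩)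
  refine ⟨u, ?_, fun x => ?_⟩
  · have h1 := Measure.countable_meas_pos_of_disjoint_iUnion (μ := μ)
      (As := fun x : u => ball (x : X) (ε / 2)) (fun x => measurableSet_ball)
      (fun a b hab => hu a.2 b.2 (fun hh => hab (Subtype.ext hh)))
    have h2 : {i : u | 0 < μ (ball (i : X) (ε / 2))} = univ :=
      eq_univ_of_forall fun i => h.ball_pos _ _ (by positivity)
    rw [h2] at h1
    exact countable_coe_iff.1 (countable_univ_iff.1 h1)
  · obtain ⟨y, hy, ⟨z, hz⟩, -⟩ := hcov x (mem_univ _)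
    refine ⟨y, hy, ?_⟩
    have h1 := mem_ball'.1 hz.1
    have h2 := mem_ball.1 hz.2
    linarith [dist_triangle x z y]

/-- **Lebesgue's density theorem**, for open balls. -/
lemma ae_eventually_measure_diff_le (h : IsDoublingMeasure c μ) (hc : 1 < c) {E : Set X}
    (hE : NullMeasurableSet E μ) : ∀ᵐ x ∂μ, x ∈ E → ∀ η : ℝ, 0 < η → ∀ᶠ r in 𝓝[>] (0 : ℝ),
      μ (ball x r \ E) ≤ ENNReal.ofReal η * μ (ball x r) := by
  have := h.secondCountableTopology
  have := h.isLocallyFiniteMeasure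
  have := h.isUnifLocDoublingMeasure hc
  have key := IsUnifLocDoublingMeasure.ae_tendsto_measure_inter_div μ E 1
  rw [ae_restrict_iff'₀ hE] at key
  filter_upwards [key] with x hx hxE η hη
  have hT : Tendsto (fun r : ℝ => μ (E ∩ closedBall x r) / μ (closedBall x r)) (𝓝[>] 0) (𝓝 1) :=
    hx hxE (fun _ => x) id tendsto_id (by
    filter_upwards [self_mem_nhdsWithin] with r hr
    exact mem_closedBall_self (by simpa using (le_of_lt hr)))
  have hc0 : 0 < η / c := by positivity
  have hlt : (1 : ℝ≥0∞) - ENNReal.ofReal (η / c) < 1 :=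
    ENNReal.sub_lt_self (by simp) (by simp) (by simpa using hc0)
  filter_upwards [hT.eventually (lt_mem_nhds hlt), self_mem_nhdsWithin] with r hr hr0
  have hr0 : 0 < r := hr0
  have hle : μ (closedBall x r) ≤ ENNReal.ofReal c * μ (ball x r) :=
    (measure_mono (closedBall_subset_ball (by linarith))).trans (h.measure_ball_le x hr0)
  have hne0 : μ (closedBall x r) ≠ 0 := fun h0 => h.ball_ne_zero x hr0
    (measure_mono_null ball_subset_closedBall h0)
  have hnet : μ (closedBall x r) ≠ ∞ :=
    (hle.trans_lt (ENNReal.mul_lt_top (by simp) (h.ball_lt_top x r hr0))).ne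
  -- split the closed ball into its parts inside and outside of `E`
  have hsplit : μ (E ∩ closedBall x r) + μ (closedBall x r \ E) = μ (closedBall x r) := by
    rw [inter_comm]; exact measure_inter_add_sdiff₀ _ hE
  have h1 : μ (closedBall x r) ≤ μ (E ∩ closedBall x r) +
      ENNReal.ofReal (η / c) * μ (closedBall x r) := by
    have h2 : 1 ≤ μ (E ∩ closedBall x r) / μ (closedBall x r) + ENNReal.ofReal (η / c) :=
      tsub_le_iff_right.1 hr.le
    calc μ (closedBall x r) = 1 * μ (closedBall x r) := (one_mul _).symm
      _ ≤ (μ (E ∩ closedBall x r) / μ (closedBall x r) + ENNReal.ofReal (η / c)) *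
          μ (closedBall x r) := mul_le_mul_left h2 _
      _ = _ := by rw [add_mul, ENNReal.div_mul_cancel hne0 hnet]
  have h3 : μ (closedBall x r \ E) ≤ ENNReal.ofReal (η / c) * μ (closedBall x r) := by
    rw [← hsplit] at h1
    refine (ENNReal.add_le_add_iff_left ?_).1 (h1.trans_eq (by rw [hsplit]))
    exact ne_top_of_le_ne_top hnet (measure_mono inter_subset_right)
  calc μ (ball x r \ E) ≤ μ (closedBall x r \ E) :=
        measure_mono (sdiff_subset_sdiff_left ball_subset_closedBall)
    _ ≤ ENNReal.ofReal (η / c) * (ENNReal.ofReal c * μ (ball x r)) :=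
        h3.trans (mul_le_mul_right hle _)
    _ = ENNReal.ofReal η * μ (ball x r) := by
        rw [← mul_assoc, ← ENNReal.ofReal_mul hc0.le, div_mul_cancel₀ _ (by positivity)]

/-- Vitali covering in the form in which it is used throughout: a bound for `A` on the ball of
radius `4 r x` by `G` on the ball of radius `r x` around every point `x ∈ A` gives the same bound
for the whole sets. -/
lemma measure_le_mul_of_forall_ball (h : IsDoublingMeasure c μ) {A G : Set X} {κ : ℝ≥0∞} {R : ℝ}
    (r : X → ℝ) (hr0 : ∀ x ∈ A, 0 < r x) (hrR : ∀ x ∈ A, r x ≤ R)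
    (hAG : ∀ x ∈ A, μ (A ∩ ball x (4 * r x)) ≤ κ * μ (G ∩ ball x (r x))) : μ A ≤ κ * μ G := by
  have := h.secondCountableTopology
  obtain ⟨u, huA, hu, hcov⟩ := Vitali.exists_disjoint_subfamily_covering_enlargement
    (fun x : X => ball x (r x)) A r 2 one_lt_two (fun x hx => (hr0 x hx).le) R hrR
    (fun x hx => ⟨x, mem_ball_self (hr0 x hx)⟩)
  have huc : u.Countable := hu.countable_of_isOpen (fun _ _ => isOpen_ball)
    (fun x hx => ⟨x, mem_ball_self (hr0 x (huA hx))⟩)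
  have hsub : A ⊆ ⋃ x ∈ u, A ∩ ball x (4 * r x) := by
    intro x hx
    obtain ⟨y, hy, ⟨z, hz⟩, hxy⟩ := hcov x hx
    refine mem_iUnion₂.2 ⟨y, hy, hx, ?_⟩
    have h1 := mem_ball'.1 hz.1
    have h2 := mem_ball.1 hz.2
    have h3 := hr0 y (huA hy)
    rw [mem_ball]
    linarith [dist_triangle x z y]
  have : Countable u := huc.to_subtype
  calc μ A ≤ μ (⋃ x ∈ u, A ∩ ball x (4 * r x)) := measure_mono hsub
    _ ≤ ∑' x : u, μ (A ∩ ball (x : X) (4 * r x)) := measure_biUnion_le _ huc _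
    _ ≤ ∑' x : u, κ * (μ.restrict G) (ball (x : X) (r x)) := by
        refine ENNReal.tsum_le_tsum fun x => ?_
        rw [Measure.restrict_apply measurableSet_ball, inter_comm (ball _ _)]
        exact hAG x (huA x.2)
    _ = κ * (μ.restrict G) (⋃ x ∈ u, ball x (r x)) := by
        rw [ENNReal.tsum_mul_left, measure_biUnion huc hu fun _ _ => measurableSet_ball]
    _ ≤ κ * μ G := by
        refine mul_le_mul_right ((measure_mono (subset_univ _)).trans_eq ?_) _
        simp

end IsDoublingMeasure

end Doubling

/-! ### Exponential decay from an oscillation bound -/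

section Decay

open Filter Set Topology

variable {X : Type u} [MetricSpace X] [MeasurableSpace X] {c : ℝ} {μ : Measure X}

/-- In every ball `B(x, r)` the function `f` takes values in the interval `[m x r, m x r + s]` of
length `s`, except on a set of relative measure at most `δ`. -/
def HasOscillationBound (μ : Measure X) (f : X → ℝ) (m : X → ℝ → ℝ) (s δ : ℝ) : Prop :=
  ∀ x r, 0 < r → μ {y ∈ ball x r | f y < m x r ∨ m x r + s < f y} ≤
    ENNReal.ofReal δ * μ (ball x r)

namespace HasOscillationBound

variable {f : X → ℝ} {m : X → ℝ → ℝ} {s δ : ℝ}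

lemma neg (hf : HasOscillationBound μ f m s δ) :
    HasOscillationBound μ (fun x => -f x) (fun x r => -(m x r + s)) s δ := by
  intro x r hr
  refine (measure_mono ?_).trans (hf x r hr)
  rintro y ⟨hy, h | h⟩
  · exact ⟨hy, Or.inr (by linarith)⟩
  · exact ⟨hy, Or.inl (by linarith)⟩

/-- The intervals of two nested balls of comparable measure intersect. -/
lemma center_le (hμ : IsDoublingMeasure c μ) (hf : HasOscillationBound μ f m s δ) (hδ : 0 ≤ δ)
    (hδc : δ * (1 + c ^ 2) < 1) {x y : X} {r ρ : ℝ} (hr : 0 < r) (hρ : 0 < ρ)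
    (hsub : ball y ρ ⊆ ball x r) (hle : μ (ball x r) ≤ ENNReal.ofReal (c ^ 2) * μ (ball y ρ)) :
    m y ρ ≤ m x r + s := by
  by_contra! hlt
  have hcov : ball y ρ ⊆ {z ∈ ball y ρ | f z < m y ρ ∨ m y ρ + s < f z} ∪
      {z ∈ ball x r | f z < m x r ∨ m x r + s < f z} := by
    intro z hz
    rcases lt_or_ge (f z) (m y ρ) with h | h
    · exact Or.inl ⟨hz, Or.inl h⟩
    · exact Or.inr ⟨hsub hz, Or.inr (hlt.trans_le h)⟩
  have h1 : μ (ball y ρ) ≤ ENNReal.ofReal (δ * (1 + c ^ 2)) * μ (ball y ρ) := by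
    calc μ (ball y ρ) ≤ _ := measure_mono hcov
      _ ≤ _ := measure_union_le _ _
      _ ≤ ENNReal.ofReal δ * μ (ball y ρ) + ENNReal.ofReal δ * μ (ball x r) :=
          add_le_add (hf y ρ hρ) (hf x r hr)
      _ ≤ ENNReal.ofReal δ * μ (ball y ρ) +
          ENNReal.ofReal δ * (ENNReal.ofReal (c ^ 2) * μ (ball y ρ)) := by gcongr
      _ = _ := by
          rw [ENNReal.ofReal_mul hδ, ENNReal.ofReal_add zero_le_one (sq_nonneg c),
            ENNReal.ofReal_one]
          ring
  have h2 : ENNReal.ofReal (δ * (1 + c ^ 2)) * μ (ball y ρ) < 1 * μ (ball y ρ) :=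
    (ENNReal.mul_lt_mul_iff_left (hμ.ball_ne_zero y hρ) (hμ.ball_ne_top y hρ)).2
      (ENNReal.ofReal_lt_one.2 hδc)
  rw [one_mul] at h2
  exact absurd h1 (not_le.2 h2)

variable [BorelSpace X]

/-- The step of the good-`λ` iteration. At almost every point of the smaller superlevel set, the
centers `m x (2⁻ʲ⁻¹ r₀)` increase by at most `s` from each `j` to the next until they exceed the
lower level. At the first such `j`, the ball mostly lies in the larger superlevel set, while its
fourfold enlargement, still below the lower level, meets the smaller one in a small set. As `j` is
at least `3 k`, these balls have radius small enough to stay inside the larger ball. -/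
lemma measure_superlevel_succ_le (hμ : IsDoublingMeasure c μ) (hc : 1 < c)
    (hfm : AEMeasurable f μ) (hf : HasOscillationBound μ f m s δ) (hs : 0 < s) (hδ : 0 ≤ δ)
    (hδc : δ * (1 + c ^ 2) < 1) (x₀ : X) {r₀ : ℝ} (hr₀ : 0 < r₀) {k : ℕ} (hk : 1 ≤ k) :
    μ {x ∈ ball x₀ (r₀ * (1 + (1 / 2) ^ (k + 1))) | m x₀ (2 * r₀) + 3 * (k + 1) * s ≤ f x} ≤
      ENNReal.ofReal (δ * c ^ 2 / (1 - δ)) *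
        μ {x ∈ ball x₀ (r₀ * (1 + (1 / 2) ^ k)) | m x₀ (2 * r₀) + 3 * k * s ≤ f x} := by
  set M := m x₀ (2 * r₀)
  set G := {x ∈ ball x₀ (r₀ * (1 + (1 / 2) ^ k)) | M + 3 * k * s ≤ f x}
  set G' := {x ∈ ball x₀ (r₀ * (1 + (1 / 2) ^ (k + 1))) | M + 3 * (k + 1) * s ≤ f x}
  have hδ1 : δ < 1 := by nlinarith [sq_nonneg c]
  have hk1 : (1 : ℝ) ≤ k := by exact_mod_cast hk
  have hG' : NullMeasurableSet G' μ :=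
    measurableSet_ball.nullMeasurableSet.inter (hfm.nullMeasurable measurableSet_Ici)
  let ρ : ℕ → ℝ := fun j => r₀ * (1 / 2) ^ (j + 1)
  have hρ : ∀ j, 0 < ρ j := fun j => by positivity
  have hρs : ∀ j, 2 * ρ (j + 1) = ρ j := fun j => by simp only [ρ]; ring
  have hρT : Tendsto ρ atTop (𝓝[>] 0) := by
    refine tendsto_nhdsWithin_iff.2 ⟨?_, Eventually.of_forall hρ⟩
    have := ((tendsto_pow_atTop_nhds_zero_of_lt_one (r := (1 / 2 : ℝ)) (by norm_num)
      (by norm_num)).comp (tendsto_add_atTop_nat 1)).const_mul r₀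
    rw [mul_zero] at this
    exact this
  -- by the density theorem, the centers exceed the lower level at almost every point of `G'`
  let A := {x ∈ G' | ∃ j, M + 3 * k * s < m x (ρ j)}
  have hAG' : μ G' ≤ μ A := by
    refine measure_mono_ae ?_
    filter_upwards [hμ.ae_eventually_measure_diff_le hc hG'] with x hx hxG
    refine ⟨hxG, ?_⟩
    obtain ⟨j, hj⟩ := (hρT.eventually (hx hxG ((1 - δ) / 2) (by linarith))).exists
    refine ⟨j, ?_⟩
    by_contra! hle
    have hcov : ball x (ρ j) ⊆ (ball x (ρ j) \ G') ∪
        {y ∈ ball x (ρ j) | f y < m x (ρ j) ∨ m x (ρ j) + s < f y} := by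
      intro y hy
      by_cases hyG : y ∈ G'
      · refine Or.inr ⟨hy, Or.inr ?_⟩
        have := hyG.2
        nlinarith
      · exact Or.inl ⟨hy, hyG⟩
    have h1 : μ (ball x (ρ j)) ≤ ENNReal.ofReal ((1 - δ) / 2 + δ) * μ (ball x (ρ j)) := by
      rw [ENNReal.ofReal_add (by linarith) hδ, add_mul]
      exact (measure_mono hcov).trans ((measure_union_le _ _).trans (add_le_add hj (hf _ _ (hρ j))))
    have h2 : ENNReal.ofReal ((1 - δ) / 2 + δ) * μ (ball x (ρ j)) < 1 * μ (ball x (ρ j)) :=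
      (ENNReal.mul_lt_mul_iff_left (hμ.ball_ne_zero x (hρ j)) (hμ.ball_ne_top x (hρ j))).2
        (ENNReal.ofReal_lt_one.2 (by linarith))
    rw [one_mul] at h2
    exact absurd h1 (not_le.2 h2)
  refine hAG'.trans ?_
  have hex : ∀ x, ∃ n : ℕ, x ∈ A → M + 3 * k * s < m x (ρ n) ∧
      ∀ i < n, m x (ρ i) ≤ M + 3 * k * s := by
    intro x
    by_cases hx : x ∈ A
    · classical
      exact ⟨Nat.find hx.2, fun _ => ⟨Nat.find_spec hx.2,
        fun i hi => not_lt.1 (Nat.find_min hx.2 hi)⟩⟩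
    · exact ⟨0, fun h => absurd h hx⟩
  choose n hn using hex
  have hballk : ∀ x ∈ A, dist x x₀ < r₀ * (1 + (1 / 2) ^ (k + 1)) := fun x hx => hx.1.1
  have hpow2 : (1 / 2 : ℝ) ^ (k + 1) ≤ 1 / 4 :=
    (pow_le_pow_of_le_one (by norm_num) (by norm_num) (by omega : 2 ≤ k + 1)).trans (by norm_num)
  have hup : ∀ x ∈ A, ∀ i : ℕ, m x (ρ i) ≤ M + (i + 1) * s := by
    intro x hx i
    induction i with
    | zero =>
      have hd := hballk x hx
      have h2 : ball x₀ (2 * r₀) ∩ ball x r₀ ≠ ∅ := by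
        refine Set.Nonempty.ne_empty ⟨x, mem_ball.2 ?_, mem_ball_self hr₀⟩
        nlinarith
      have := hf.center_le hμ hδ hδc (x := x₀) (y := x) (r := 2 * r₀) (ρ := ρ 0) (by positivity)
        (hρ 0) (ball_subset_ball' (by simp only [ρ]; nlinarith)) (by
          have h3 := hμ.measure_ball_le x (hρ 0)
          have h4 : 2 * ρ 0 = r₀ := by simp only [ρ]; ring
          rw [h4] at h3
          refine (hμ.doubling x₀ x r₀ hr₀ (Set.nonempty_iff_ne_empty.2 h2)).trans
            ((mul_le_mul_right h3 _).trans_eq ?_)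
          rw [← mul_assoc, ← ENNReal.ofReal_mul (by linarith), sq])
      simpa using this
    | succ i ih =>
      have h3 := hμ.measure_ball_le x (hρ (i + 1))
      rw [hρs] at h3
      have := hf.center_le hμ hδ hδc (x := x) (y := x) (r := ρ i) (ρ := ρ (i + 1)) (hρ _)
        (hρ _) (ball_subset_ball (by linarith [hρs i, hρ (i + 1)]))
        (h3.trans (mul_le_mul_left (ENNReal.ofReal_le_ofReal (by nlinarith)) _))
      push_cast
      linarith
  have hnk : ∀ x ∈ A, 3 * k ≤ n x := by
    intro x hx
    have h1 := (hn x hx).1.trans_le (hup x hx (n x))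
    have h2 : (3 * k : ℝ) < n x + 1 := by
      by_contra! h
      nlinarith
    have h3 : 3 * k < n x + 1 := by exact_mod_cast h2
    omega
  refine hμ.measure_le_mul_of_forall_ball (R := r₀) (fun x => ρ (n x)) (fun x _ => hρ _)
    (fun x _ => ?_) (fun x hx => ?_)
  · exact mul_le_of_le_one_right hr₀.le (pow_le_one₀ (by norm_num) (by norm_num))
  · obtain ⟨i, hi⟩ : ∃ i, n x = i + 2 := ⟨n x - 2, by have := hnk x hx; omega⟩
    have hi4 : 4 * ρ (n x) = ρ i := by rw [hi, ← hρs i, ← hρs (i + 1)]; ring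
    have hlow := (hn x hx).2 i (by omega)
    have hρle : ρ (n x) ≤ r₀ * (1 / 2) ^ (k + 1) :=
      mul_le_mul_of_nonneg_left (pow_le_pow_of_le_one (by norm_num) (by norm_num)
        (by have := hnk x hx; omega)) hr₀.le
    -- the enlarged ball has not been stopped, so the smaller superlevel set is exceptional in it
    have h1 : μ (A ∩ ball x (4 * ρ (n x))) ≤ ENNReal.ofReal (δ * c ^ 2) * μ (ball x (ρ (n x))) := by
      calc μ (A ∩ ball x (4 * ρ (n x)))
          ≤ μ {y ∈ ball x (ρ i) | f y < m x (ρ i) ∨ m x (ρ i) + s < f y} := by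
            refine measure_mono fun y hy => ⟨hi4 ▸ hy.2, Or.inr ?_⟩
            have := hy.1.1.2
            nlinarith
        _ ≤ ENNReal.ofReal δ * μ (ball x (ρ i)) := hf x _ (hρ i)
        _ ≤ ENNReal.ofReal δ * (ENNReal.ofReal (c ^ 2) * μ (ball x (ρ (n x)))) := by
            rw [← hi4]
            exact mul_le_mul_right (hμ.measure_ball_four_le hc x (hρ _)) _
        _ = _ := by rw [← mul_assoc, ← ENNReal.ofReal_mul hδ]
    -- the stopped ball itself mostly lies in the larger superlevel set
    have h2 : ENNReal.ofReal (1 - δ) * μ (ball x (ρ (n x))) ≤ μ (G ∩ ball x (ρ (n x))) := by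
      have hcov : ball x (ρ (n x)) ⊆ (G ∩ ball x (ρ (n x))) ∪
          {y ∈ ball x (ρ (n x)) | f y < m x (ρ (n x)) ∨ m x (ρ (n x)) + s < f y} := by
        intro y hy
        rcases lt_or_ge (f y) (m x (ρ (n x))) with h | h
        · exact Or.inr ⟨hy, Or.inl h⟩
        · refine Or.inl ⟨⟨?_, (hn x hx).1.le.trans h⟩, hy⟩
          have hd := hballk x hx
          rw [mem_ball] at hy ⊢
          have : (1 / 2 : ℝ) ^ k = (1 / 2) ^ (k + 1) + (1 / 2) ^ (k + 1) := by ring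
          rw [this]
          linarith [dist_triangle y x x₀]
      have h3 := (measure_mono hcov).trans
        ((measure_union_le _ _).trans (add_le_add_right (hf x _ (hρ (n x))) _))
      have h4 : μ (ball x (ρ (n x))) = ENNReal.ofReal (1 - δ) * μ (ball x (ρ (n x))) +
          ENNReal.ofReal δ * μ (ball x (ρ (n x))) := by
        rw [← add_mul, ← ENNReal.ofReal_add (by linarith) hδ]; simp
      exact (ENNReal.add_le_add_iff_right (ENNReal.mul_ne_top ENNReal.ofReal_ne_top
        (hμ.ball_ne_top x (hρ (n x))))).1 (h4.symm.trans_le h3)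
    calc μ (A ∩ ball x (4 * ρ (n x)))
        ≤ ENNReal.ofReal (δ * c ^ 2) * μ (ball x (ρ (n x))) := h1
      _ = ENNReal.ofReal (δ * c ^ 2 / (1 - δ)) *
          (ENNReal.ofReal (1 - δ) * μ (ball x (ρ (n x)))) := by
          rw [← mul_assoc, ← ENNReal.ofReal_mul (by have : 0 < 1 - δ := by linarith
                                                    positivity),
            div_mul_cancel₀ _ (by linarith)]
      _ ≤ _ := mul_le_mul_right h2 _

/-- Exponential decay of the superlevel sets. The reference value is the center for the doubled
ball, which contains all the balls of the iteration. -/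
lemma measure_superlevel_le (hμ : IsDoublingMeasure c μ) (hc : 1 < c)
    (hfm : AEMeasurable f μ) (hf : HasOscillationBound μ f m s δ) (hs : 0 < s) (hδ : 0 ≤ δ)
    (hδc : δ * (1 + c ^ 2) < 1) (x₀ : X) {r₀ : ℝ} (hr₀ : 0 < r₀) (k : ℕ) :
    μ {x ∈ ball x₀ r₀ | m x₀ (2 * r₀) + 3 * (k + 1) * s ≤ f x} ≤
      ENNReal.ofReal (c * (δ * c ^ 2 / (1 - δ)) ^ k) * μ (ball x₀ r₀) := by
  have hq : 0 ≤ δ * c ^ 2 / (1 - δ) := by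
    have : 0 < 1 - δ := by nlinarith [sq_nonneg c]
    positivity
  have key : μ {x ∈ ball x₀ (r₀ * (1 + (1 / 2) ^ (k + 1))) |
      m x₀ (2 * r₀) + 3 * (k + 1) * s ≤ f x} ≤
        ENNReal.ofReal (δ * c ^ 2 / (1 - δ)) ^ k * μ (ball x₀ (2 * r₀)) := by
    induction k with
    | zero =>
      simp only [pow_zero, one_mul]
      refine measure_mono fun x hx => ball_subset_ball ?_ hx.1
      norm_num
      linarith
    | succ k ih =>
      have h1 := hf.measure_superlevel_succ_le hμ hc hfm hs hδ hδc x₀ hr₀ (k := k + 1) (by omega)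
      rw [pow_succ' (ENNReal.ofReal _) k, mul_assoc (ENNReal.ofReal _)]
      refine h1.trans (mul_le_mul_right ?_ _)
      push_cast
      exact ih
  calc _ ≤ μ {x ∈ ball x₀ (r₀ * (1 + (1 / 2) ^ (k + 1))) |
          m x₀ (2 * r₀) + 3 * (k + 1) * s ≤ f x} := measure_mono fun x hx =>
        ⟨ball_subset_ball (le_mul_of_one_le_right hr₀.le (by simp)) hx.1, hx.2⟩
    _ ≤ _ := key
    _ ≤ ENNReal.ofReal (δ * c ^ 2 / (1 - δ)) ^ k * (ENNReal.ofReal c * μ (ball x₀ r₀)) :=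
        mul_le_mul_right (hμ.measure_ball_le x₀ hr₀) _
    _ = _ := by
        rw [ENNReal.ofReal_mul (by linarith), ENNReal.ofReal_pow hq, ← mul_assoc,
          mul_comm (ENNReal.ofReal c)]

lemma measure_abs_sub_le (hμ : IsDoublingMeasure c μ) (hc : 1 < c)
    (hfm : AEMeasurable f μ) (hf : HasOscillationBound μ f m s δ) (hs : 0 < s) (hδ : 0 ≤ δ)
    (hδc : δ * (1 + c ^ 2) < 1) (x₀ : X) {r₀ : ℝ} (hr₀ : 0 < r₀) (k : ℕ) :
    μ {x ∈ ball x₀ r₀ | 3 * s * (k + 1) ≤ |f x - m x₀ (2 * r₀)|} ≤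
      ENNReal.ofReal (2 * c * (δ * c ^ 2 / (1 - δ)) ^ k) * μ (ball x₀ r₀) := by
  have hq : 0 ≤ δ * c ^ 2 / (1 - δ) := by
    have : 0 < 1 - δ := by nlinarith [sq_nonneg c]
    positivity
  have h1 := hf.measure_superlevel_le hμ hc hfm hs hδ hδc x₀ hr₀ k
  have h2 := hf.neg.measure_superlevel_le hμ hc hfm.neg hs hδ hδc x₀ hr₀ k
  have h3 : (0 : ℝ) ≤ c * (δ * c ^ 2 / (1 - δ)) ^ k := by positivity
  calc _ ≤ _ := measure_mono (t := {x ∈ ball x₀ r₀ | m x₀ (2 * r₀) + 3 * (k + 1) * s ≤ f x} ∪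
        {x ∈ ball x₀ r₀ | -(m x₀ (2 * r₀) + s) + 3 * (k + 1) * s ≤ -f x}) (by
          rintro x ⟨hx, h⟩
          rcases le_abs.1 h with h | h
          · exact Or.inl ⟨hx, by linarith⟩
          · exact Or.inr ⟨hx, by linarith⟩)
    _ ≤ _ := measure_union_le _ _
    _ ≤ _ := add_le_add h1 h2
    _ = _ := by
        rw [← add_mul, ← ENNReal.ofReal_add h3 h3]
        ring_nf

end HasOscillationBound

end Decay

/-! ### Mean oscillation and separation of level sets -/

section MeanOscillation

open Filter Set Topology

variable {X : Type u} [MetricSpace X] [MeasurableSpace X] {c : ℝ} {μ : Measure X}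

lemma enorm_average_le {α : Type*} [MeasurableSpace α] (ν : Measure α) (g : α → ℝ) :
    ‖⨍ x, g x ∂ν‖ₑ ≤ (∫⁻ x, ‖g x‖ₑ ∂ν) / ν univ := by
  refine (enorm_integral_le_lintegral_enorm _).trans_eq ?_
  rw [lintegral_smul_measure, smul_eq_mul, ENNReal.div_eq_inv_mul]

/-- The mean is, up to a factor `2`, the best constant. -/
lemma lintegral_sub_average_le {α : Type*} [MeasurableSpace α] {μ : Measure α} {B : Set α}
    {g : α → ℝ} (h0 : μ B ≠ 0) (ht : μ B ≠ ∞)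
    (hg : IntegrableOn g B μ) (a : ℝ) :
    ∫⁻ y in B, ‖g y - ⨍ z in B, g z ∂μ‖ₑ ∂μ ≤ 2 * ∫⁻ y in B, ‖g y - a‖ₑ ∂μ := by
  have : IsFiniteMeasure (μ.restrict B) := ⟨by simpa using ht.lt_top⟩
  have : NeZero (μ.restrict B) := ⟨by simpa using h0⟩
  have h1 : a - ⨍ z in B, g z ∂μ = -⨍ z in B, (g z - a) ∂μ := by
    have hμ0 : (μ.real B) ≠ 0 := by simp [measureReal_def, ENNReal.toReal_eq_zero_iff, h0, ht]
    rw [setAverage_eq, setAverage_eq, integral_sub hg (integrable_const a)]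
    simp [mul_sub, hμ0]
  calc ∫⁻ y in B, ‖g y - ⨍ z in B, g z ∂μ‖ₑ ∂μ
      ≤ ∫⁻ y in B, (‖g y - a‖ₑ + ‖a - ⨍ z in B, g z ∂μ‖ₑ) ∂μ := by
        refine lintegral_mono fun y => ?_
        rw [show g y - ⨍ z in B, g z ∂μ = (g y - a) + (a - ⨍ z in B, g z ∂μ) by ring]
        exact enorm_add_le _ _
    _ = ∫⁻ y in B, ‖g y - a‖ₑ ∂μ + ‖a - ⨍ z in B, g z ∂μ‖ₑ * μ B := by
        rw [lintegral_add_right _ measurable_const]; simp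
    _ ≤ ∫⁻ y in B, ‖g y - a‖ₑ ∂μ + ∫⁻ y in B, ‖g y - a‖ₑ ∂μ := by
        gcongr
        rw [h1, enorm_neg]
        refine (mul_le_mul_left (enorm_average_le _ _) _).trans ?_
        rw [Measure.restrict_apply_univ]
        exact (ENNReal.div_mul_cancel h0 ht).le
    _ = _ := (two_mul _).symm

lemma bmoNorm_le_iff {f : X → ℝ} {M : ℝ≥0∞} : bmoNorm μ f ≤ M ↔ ∀ x r, 0 < r →
    (∫⁻ y in ball x r, ‖f y - ⨍ z in ball x r, f z ∂μ‖ₑ ∂μ) / μ (ball x r) ≤ M := by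
  simp [bmoNorm, iSup_le_iff]

lemma lintegral_sub_average_le_bmoNorm (hμ : IsDoublingMeasure c μ) (f : X → ℝ) (x : X) {r : ℝ}
    (hr : 0 < r) : ∫⁻ y in ball x r, ‖f y - ⨍ z in ball x r, f z ∂μ‖ₑ ∂μ ≤
      bmoNorm μ f * μ (ball x r) :=
  (ENNReal.div_le_iff (hμ.ball_ne_zero x hr) (hμ.ball_ne_top x hr)).1
    (bmoNorm_le_iff.1 le_rfl x r hr)

/-- A function whose oscillation about some constant is bounded on every ball is in `BMO`. -/
lemma memBMO_of_lintegral_sub_le (hμ : IsDoublingMeasure c μ) {f : X → ℝ} (hf : AEMeasurable f μ)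
    {M : ℝ} (h : ∀ x r, 0 < r → ∃ a : ℝ,
      ∫⁻ y in ball x r, ‖f y - a‖ₑ ∂μ ≤ ENNReal.ofReal M * μ (ball x r)) :
    MemBMO μ f ∧ bmoNorm μ f ≤ ENNReal.ofReal (2 * M) := by
  have hint : ∀ x r, 0 < r → IntegrableOn f (ball x r) μ := by
    intro x r hr
    obtain ⟨a, ha⟩ := h x r hr
    have : IsFiniteMeasure (μ.restrict (ball x r)) := ⟨by simpa using hμ.ball_lt_top x r hr⟩
    have h1 : IntegrableOn (fun y => f y - a) (ball x r) μ :=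
      ⟨(hf.sub_const a).aestronglyMeasurable.restrict,
        ha.trans_lt (ENNReal.mul_lt_top (by simp) (hμ.ball_lt_top x r hr))⟩
    simpa [Pi.add_def] using h1.add (integrable_const a)
  have hle : bmoNorm μ f ≤ ENNReal.ofReal (2 * M) := by
    refine bmoNorm_le_iff.2 fun x r hr => ?_
    rw [ENNReal.div_le_iff (hμ.ball_ne_zero x hr) (hμ.ball_ne_top x hr)]
    obtain ⟨a, ha⟩ := h x r hr
    refine (lintegral_sub_average_le (hμ.ball_ne_zero x hr) (hμ.ball_ne_top x hr)
      (hint x r hr) a).trans ((mul_le_mul_right ha _).trans_eq ?_)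
    rw [ENNReal.ofReal_mul zero_le_two, mul_assoc, ENNReal.ofReal_ofNat]
  exact ⟨⟨fun x => ⟨ball x 1, ball_mem_nhds x one_pos,
    hint x 1 one_pos⟩, hle.trans_lt ENNReal.ofReal_lt_top⟩, hle⟩

/-- Discrete layer-cake bound. -/
lemma ofReal_le_add_tsum_indicator {α : Type*} (w : α → ℝ) {a : ℝ} (ha : 0 < a) (y : α) :
    ENNReal.ofReal (w y) ≤ ENNReal.ofReal a +
      ∑' k : ℕ, {z | a * (k + 1) ≤ w z}.indicator (fun _ => ENNReal.ofReal a) y := by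
  rcases lt_or_ge (w y) 0 with h | h
  · simp [ENNReal.ofReal_of_nonpos h.le]
  set n := ⌊w y / a⌋₊
  have h1 : w y < a * (n + 1) := by
    have := Nat.lt_floor_add_one (w y / a)
    rwa [div_lt_iff₀ ha, mul_comm] at this
  have h2 : a * n ≤ w y := by
    have := Nat.floor_le (a := w y / a) (by positivity)
    rwa [le_div_iff₀ ha, mul_comm] at this
  calc ENNReal.ofReal (w y) ≤ ENNReal.ofReal (a + n * a) :=
        ENNReal.ofReal_le_ofReal (by linarith)
    _ = ENNReal.ofReal a + ∑ k ∈ Finset.range n, ENNReal.ofReal a := by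
        rw [ENNReal.ofReal_add ha.le (by positivity), ENNReal.ofReal_mul (by positivity)]
        simp
    _ = ENNReal.ofReal a + ∑ k ∈ Finset.range n,
          {z | a * (k + 1) ≤ w z}.indicator (fun _ => ENNReal.ofReal a) y := by
        congr 1
        refine Finset.sum_congr rfl fun k hk => ?_
        have hk' : (k + 1 : ℝ) ≤ n := by exact_mod_cast Finset.mem_range.1 hk
        rw [indicator_of_mem]
        exact (mul_le_mul_of_nonneg_left hk' ha.le).trans h2
    _ ≤ _ := by gcongr; exact ENNReal.sum_le_tsum _

lemma HasOscillationBound.memBMO [BorelSpace X] (hμ : IsDoublingMeasure c μ) (hc : 1 < c)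
    {f : X → ℝ} {m : X → ℝ → ℝ} {s δ : ℝ} (hfm : AEMeasurable f μ)
    (hf : HasOscillationBound μ f m s δ) (hs : 0 < s) (hδ : 0 ≤ δ) (hδc : δ * (1 + c ^ 2) < 1) :
    MemBMO μ f ∧ bmoNorm μ f ≤
      ENNReal.ofReal (6 * (1 + 2 * c * (1 - δ * c ^ 2 / (1 - δ))⁻¹) * s) := by
  set q := δ * c ^ 2 / (1 - δ)
  have hδ1 : 0 < 1 - δ := by nlinarith [sq_nonneg c]
  have hq : 0 ≤ q := by positivity
  have hq1 : q < 1 := by rw [div_lt_one hδ1]; linarith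
  have hq1' : 0 < 1 - q := by linarith
  rw [show 6 * (1 + 2 * c * (1 - q)⁻¹) * s = 2 * (3 * s * (1 + 2 * c * (1 - q)⁻¹)) by ring]
  refine memBMO_of_lintegral_sub_le hμ hfm fun x r hr => ⟨m x (2 * r), ?_⟩
  have hsm : ∀ k : ℕ, NullMeasurableSet {y | 3 * s * (k + 1) ≤ |f y - m x (2 * r)|}
      (μ.restrict (ball x r)) := fun k => by
    have : AEMeasurable (fun y => |f y - m x (2 * r)|) (μ.restrict (ball x r)) :=
      (continuous_abs.measurable.comp_aemeasurable (hfm.sub_const _)).restrict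
    exact this.nullMeasurable measurableSet_Ici
  calc ∫⁻ y in ball x r, ‖f y - m x (2 * r)‖ₑ ∂μ
      = ∫⁻ y in ball x r, ENNReal.ofReal (|f y - m x (2 * r)|) ∂μ := by
        simp [Real.enorm_eq_ofReal_abs]
    _ ≤ ∫⁻ y in ball x r, (ENNReal.ofReal (3 * s) + ∑' k : ℕ,
          {z | 3 * s * (k + 1) ≤ |f z - m x (2 * r)|}.indicator
            (fun _ => ENNReal.ofReal (3 * s)) y) ∂μ :=
        lintegral_mono fun y => ofReal_le_add_tsum_indicator
          (fun z => |f z - m x (2 * r)|) (by positivity) y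
    _ = ENNReal.ofReal (3 * s) * μ (ball x r) + ∑' k : ℕ, ENNReal.ofReal (3 * s) *
          μ {y ∈ ball x r | 3 * s * (k + 1) ≤ |f y - m x (2 * r)|} := by
        rw [lintegral_add_left measurable_const, lintegral_tsum fun k =>
          aemeasurable_const.indicator₀ (hsm k)]
        simp only [lintegral_const, Measure.restrict_apply_univ]
        congr 2
        ext k
        rw [lintegral_indicator_const₀ (hsm k), Measure.restrict_apply' measurableSet_ball,
          inter_comm]
        rfl
    _ ≤ ENNReal.ofReal (3 * s) * μ (ball x r) + ∑' k : ℕ, ENNReal.ofReal (3 * s) *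
          (ENNReal.ofReal (2 * c * q ^ k) * μ (ball x r)) := by
        gcongr with k
        exact hf.measure_abs_sub_le hμ hc hfm hs hδ hδc x hr k
    _ = ENNReal.ofReal (3 * s) * μ (ball x r) + ENNReal.ofReal (3 * s) *
          (ENNReal.ofReal (2 * c * (1 - q)⁻¹) * μ (ball x r)) := by
        rw [ENNReal.tsum_mul_left, ENNReal.tsum_mul_right, ← ENNReal.ofReal_tsum_of_nonneg
          (fun k => by positivity) ((summable_geometric_of_lt_one hq hq1).mul_left _),
          tsum_mul_left, tsum_geometric_of_lt_one hq hq1]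
    _ = _ := by
        rw [← mul_assoc, ← ENNReal.ofReal_mul (by positivity), ← add_mul,
          ← ENNReal.ofReal_add (by positivity) (by positivity)]
        ring_nf

lemma supMinDensity_le_iff (hμ : IsDoublingMeasure c μ) {E₁ E₂ : Set X} {a : ℝ≥0∞} :
    supMinDensity μ E₁ E₂ ≤ a ↔ ∀ x r, 0 < r →
      μ (E₁ ∩ ball x r) ≤ a * μ (ball x r) ∨ μ (E₂ ∩ ball x r) ≤ a * μ (ball x r) := by
  simp only [supMinDensity, iSup_le_iff, min_le_iff]
  refine forall_congr' fun x => forall_congr' fun r => forall_congr' fun hr => ?_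
  rw [ENNReal.div_le_iff (hμ.ball_ne_zero x hr) (hμ.ball_ne_top x hr),
    ENNReal.div_le_iff (hμ.ball_ne_zero x hr) (hμ.ball_ne_top x hr)]

lemma supMinDensity_mono {E₁ E₂ G₁ G₂ : Set X} (h1 : E₁ ⊆ G₁) (h2 : E₂ ⊆ G₂) :
    supMinDensity μ E₁ E₂ ≤ supMinDensity μ G₁ G₂ := by
  unfold supMinDensity; gcongr

/-- A scale `s` at which the level sets of `f` are separated up to joint density `γ`. -/
def LevelSetsSeparated (μ : Measure X) (f : X → ℝ) (s γ : ℝ) : Prop :=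
  ∀ t : ℝ, supMinDensity μ {x | f x < t} {x | t + s < f x} ≤ ENNReal.ofReal γ

lemma levelSetsSeparated_of_supMinDensity_le {f : X → ℝ} {T γ : ℝ}
    (h : ∀ t, supMinDensity μ {x | f x ≤ t} {x | t + T ≤ f x} ≤ ENNReal.ofReal γ) :
    LevelSetsSeparated μ f T γ := by
  intro t
  have h1 : {x | f x < t} ⊆ {x | f x ≤ t} := fun x (hx : f x < t) => hx.le
  have h2 : {x | t + T < f x} ⊆ {x | t + T ≤ f x} := fun x (hx : t + T < f x) => hx.le
  exact (supMinDensity_mono h1 h2).trans (h t)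

/-- The center `m x r` is the `γ`-quantile of `f` on the ball. -/
lemma LevelSetsSeparated.exists_hasOscillationBound (hμ : IsDoublingMeasure c μ) {f : X → ℝ}
    {s γ : ℝ} (hγ1 : γ < 1) (hf : LevelSetsSeparated μ f s γ) :
    ∃ m, HasOscillationBound μ f m s (2 * γ) := by
  have key : ∀ x r, 0 < r → ∃ a : ℝ, μ {y ∈ ball x r | f y < a ∨ a + s < f y} ≤
      ENNReal.ofReal (2 * γ) * μ (ball x r) := by
    intro x r hr
    have hB0 := hμ.ball_ne_zero x hr
    have hBt := hμ.ball_ne_top x hr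
    have hlt : ENNReal.ofReal γ * μ (ball x r) < μ (ball x r) := by
      have := (ENNReal.mul_lt_mul_iff_left hB0 hBt).2 (ENNReal.ofReal_lt_one.2 hγ1)
      rwa [one_mul] at this
    have hsep : ∀ t, μ ({y | f y < t} ∩ ball x r) ≤ ENNReal.ofReal γ * μ (ball x r) ∨
        μ ({y | t + s < f y} ∩ ball x r) ≤ ENNReal.ofReal γ * μ (ball x r) := fun t =>
      (supMinDensity_le_iff hμ).1 (hf t) x r hr
    let T := {t : ℝ | μ ({y | f y < t} ∩ ball x r) ≤ ENNReal.ofReal γ * μ (ball x r)}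
    have hTdown : ∀ t ∈ T, ∀ t' ≤ t, t' ∈ T := fun t ht t' htt =>
      (measure_mono (inter_subset_inter_left _ fun y hy => lt_of_lt_of_le hy htt)).trans ht
    have hTne : T.Nonempty := by
      have hU : ⋃ n : ℕ, {y | -(n : ℝ) < f y} ∩ ball x r = ball x r := by
        rw [← iUnion_inter, inter_eq_right]
        intro y _
        obtain ⟨n, hn⟩ := exists_nat_gt (-f y)
        exact mem_iUnion.2 ⟨n, show -(n : ℝ) < f y by linarith⟩
      have hmono : Monotone fun n : ℕ => {y | -(n : ℝ) < f y} ∩ ball x r :=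
        fun n n' hn => inter_subset_inter_left _ fun y (hy : _ < _) =>
          show -(n' : ℝ) < f y from (neg_le_neg (Nat.cast_le.2 hn)).trans_lt hy
      have hM := hmono.measure_iUnion (μ := μ)
      rw [hU] at hM
      obtain ⟨n, hn⟩ := lt_iSup_iff.1 (hlt.trans_eq hM)
      refine ⟨-n - s, (hsep (-n - s)).resolve_right (not_le.2 ?_)⟩
      simpa using hn
    have hTbdd : BddAbove T := by
      have hU : ⋃ n : ℕ, {y | f y < n} ∩ ball x r = ball x r := by
        rw [← iUnion_inter, inter_eq_right]
        intro y _
        obtain ⟨n, hn⟩ := exists_nat_gt (f y)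
        exact mem_iUnion.2 ⟨n, hn⟩
      have hmono : Monotone fun n : ℕ => {y | f y < (n : ℝ)} ∩ ball x r :=
        fun n n' hn => inter_subset_inter_left _ fun y (hy : _ < _) =>
          show f y < (n' : ℝ) from hy.trans_le (Nat.cast_le.2 hn)
      have hM := hmono.measure_iUnion (μ := μ)
      rw [hU] at hM
      obtain ⟨n, hn⟩ := lt_iSup_iff.1 (hlt.trans_eq hM)
      refine ⟨n, fun t ht => ?_⟩
      by_contra! h
      exact absurd (hTdown t ht n h.le) (not_le.2 hn)
    set a := sSup T
    obtain ⟨u, hu_mono, hu_lt, hu⟩ := exists_seq_strictMono_tendsto a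
    have hlow : μ ({y | f y < a} ∩ ball x r) ≤ ENNReal.ofReal γ * μ (ball x r) := by
      have hU : ⋃ n, {y | f y < u n} ∩ ball x r = {y | f y < a} ∩ ball x r := by
        rw [← iUnion_inter]
        congr 1
        ext y
        simp only [mem_iUnion, mem_ofPred_eq]
        exact ⟨fun ⟨n, hn⟩ => hn.trans (hu_lt n), fun hy => (hu.eventually (lt_mem_nhds hy)).exists⟩
      have hmono : Monotone fun n : ℕ => {y | f y < u n} ∩ ball x r :=
        fun n n' hn => inter_subset_inter_left _ fun y hy => lt_of_lt_of_le hy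
          (hu_mono.monotone hn)
      rw [← hU, hmono.measure_iUnion]
      refine iSup_le fun n => ?_
      obtain ⟨t, ht, hlt⟩ := exists_lt_of_lt_csSup hTne (hu_lt n)
      exact hTdown t ht _ hlt.le
    obtain ⟨v, hv_anti, hv_gt, hv⟩ := exists_seq_strictAnti_tendsto a
    have hhigh : μ ({y | a + s < f y} ∩ ball x r) ≤ ENNReal.ofReal γ * μ (ball x r) := by
      have hU : ⋃ n, {y | v n + s < f y} ∩ ball x r = {y | a + s < f y} ∩ ball x r := by
        rw [← iUnion_inter]
        congr 1
        ext y
        simp only [mem_iUnion, mem_ofPred_eq]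
        refine ⟨fun ⟨n, hn⟩ => by linarith [hv_gt n], fun hy => ?_⟩
        obtain ⟨n, hn⟩ := (hv.eventually (gt_mem_nhds (show a < f y - s by linarith))).exists
        exact ⟨n, by linarith⟩
      have hmono : Monotone fun n : ℕ => {y | v n + s < f y} ∩ ball x r :=
        fun n n' hn => inter_subset_inter_left _ fun y hy => by
          have h1 := hv_anti.antitone hn
          have h2 : v n + s < f y := hy
          exact show v n' + s < f y by linarith
      rw [← hU, hmono.measure_iUnion]
      exact iSup_le fun n => (hsep (v n)).resolve_left fun h =>
        absurd (le_csSup hTbdd h) (not_le.2 (hv_gt n))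
    refine ⟨a, ?_⟩
    calc _ ≤ _ := measure_mono (t := ({y | f y < a} ∩ ball x r) ∪ ({y | a + s < f y} ∩ ball x r))
          (by rintro y ⟨hy, h | h⟩; exacts [Or.inl ⟨h, hy⟩, Or.inr ⟨h, hy⟩])
      _ ≤ _ := measure_union_le _ _
      _ ≤ _ := add_le_add hlow hhigh
      _ = _ := by
          rw [← two_mul, ← mul_assoc, ENNReal.ofReal_mul zero_le_two, ENNReal.ofReal_ofNat]
  choose! m hm using key
  exact ⟨m, hm⟩

/-- **Strömberg's characterization of `BMO`**, quantitatively. The bound on `γ` ensures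
`2 γ (1 + c ^ 2) < 1`, as needed for the decay of the superlevel sets. -/
lemma exists_bmoNorm_le_of_levelSetsSeparated (hc : 1 < c) {γ : ℝ} (hγ : 0 ≤ γ)
    (hγc : γ < 1 / (4 * c ^ 3)) : ∃ C : ℝ, 0 < C ∧
      ∀ (X : Type u) [MetricSpace X] [MeasurableSpace X] [BorelSpace X] (μ : Measure X),
        IsDoublingMeasure c μ → ∀ (f : X → ℝ) (s : ℝ), AEMeasurable f μ → 0 < s →
          LevelSetsSeparated μ f s γ → MemBMO μ f ∧ bmoNorm μ f ≤ ENNReal.ofReal (C * s) := by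
  have hc3 : 1 + c ^ 2 < 2 * c ^ 3 := by
    nlinarith [sq_nonneg c, mul_pos (sub_pos.2 hc) (sub_pos.2 hc)]
  have h1 : γ * (4 * c ^ 3) < 1 := (lt_div_iff₀ (by positivity)).1 hγc
  have hδc : 2 * γ * (1 + c ^ 2) < 1 := by nlinarith
  have hγ1 : γ < 1 := by nlinarith [sq_nonneg c]
  have hδ1 : 0 < 1 - 2 * γ := by nlinarith [sq_nonneg c]
  have hq1 : 0 < 1 - 2 * γ * c ^ 2 / (1 - 2 * γ) := by
    rw [sub_pos, div_lt_one hδ1]; linarith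
  refine ⟨6 * (1 + 2 * c * (1 - 2 * γ * c ^ 2 / (1 - 2 * γ))⁻¹), by positivity, ?_⟩
  intro X _ _ _ μ hμ f s hfm hs hf
  obtain ⟨m, hm⟩ := hf.exists_hasOscillationBound hμ hγ1
  exact hm.memBMO hμ hc hfm hs (by linarith) hδc

end MeanOscillation

/-! ### The John–Nirenberg inequality -/

section JohnNirenberg

open Filter Set Topology

variable {X : Type u} [MetricSpace X] [MeasurableSpace X] {c : ℝ} {μ : Measure X}

lemma supMinDensity_le_one (hμ : IsDoublingMeasure c μ) (E₁ E₂ : Set X) :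
    supMinDensity μ E₁ E₂ ≤ 1 :=
  (supMinDensity_le_iff hμ).2 fun x r _ => Or.inl (by
    rw [one_mul]; exact measure_mono inter_subset_right)

/-- Chebyshev's inequality. -/
lemma hasOscillationBound_of_bmoNorm_le (hμ : IsDoublingMeasure c μ) {f : X → ℝ}
    (hfm : AEMeasurable f μ) {N s : ℝ} (hs : 0 < s) (hN : bmoNorm μ f ≤ ENNReal.ofReal N) :
    HasOscillationBound μ f (fun x r => (⨍ z in ball x r, f z ∂μ) - s / 2) s (2 * N / s) := by
  intro x r hr
  set a := ⨍ z in ball x r, f z ∂μ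
  have h1 : ENNReal.ofReal (s / 2) * μ {y ∈ ball x r | f y < a - s / 2 ∨ a - s / 2 + s < f y} ≤
      ENNReal.ofReal N * μ (ball x r) := by
    calc _ ≤ ENNReal.ofReal (s / 2) *
          (μ.restrict (ball x r)) {y | ENNReal.ofReal (s / 2) ≤ ‖f y - a‖ₑ} := by
          refine mul_le_mul_right ?_ _
          refine le_trans (measure_mono ?_) (Measure.le_restrict_apply _ _)
          rintro y ⟨hy, h⟩
          refine ⟨?_, hy⟩
          rw [mem_ofPred_eq, Real.enorm_eq_ofReal_abs]
          refine ENNReal.ofReal_le_ofReal (le_abs.2 ?_)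
          rcases h with h | h
          · exact Or.inr (by linarith)
          · exact Or.inl (by linarith)
      _ ≤ ∫⁻ y in ball x r, ‖f y - a‖ₑ ∂μ :=
          mul_meas_ge_le_lintegral₀ (hfm.sub_const a).enorm.restrict _
      _ ≤ bmoNorm μ f * μ (ball x r) := lintegral_sub_average_le_bmoNorm hμ f x hr
      _ ≤ _ := mul_le_mul_left hN _
  have hs2 : 0 < s / 2 := by linarith
  have h2 : ENNReal.ofReal N = ENNReal.ofReal (s / 2) * ENNReal.ofReal (2 * N / s) := by
    rw [← ENNReal.ofReal_mul hs2.le]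
    congr 1
    field_simp
  rw [h2, mul_assoc] at h1
  exact (ENNReal.mul_le_mul_iff_right (by simpa using hs2) (by simp)).1 h1

/-- The **John–Nirenberg inequality**, as exponential decay of the joint density of two level
sets. -/
lemma exists_supMinDensity_level_le (hc : 1 < c) : ∃ C a : ℝ, 1 ≤ C ∧ 0 < a ∧
    ∀ (X : Type u) [MetricSpace X] [MeasurableSpace X] [BorelSpace X] (μ : Measure X),
      IsDoublingMeasure c μ → ∀ (f : X → ℝ) (N : ℝ), AEMeasurable f μ → 0 < N →
        bmoNorm μ f ≤ ENNReal.ofReal N → ∀ t T : ℝ, 0 < T →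
          supMinDensity μ {x | f x ≤ t} {x | t + T ≤ f x} ≤
            ENNReal.ofReal (C * Real.exp (-(a * T / N))) := by
  refine ⟨c * Real.exp 2, 1 / (48 * c ^ 3), ?_, by positivity, ?_⟩
  · nlinarith [Real.add_one_le_exp 2]
  intro X _ _ _ μ hμ f N hfm hN hf t T hT
  -- with this `s`, Chebyshev's inequality gives an exceptional part of at most `δ = 1 / (4 c ^ 3)`
  set s := 8 * c ^ 3 * N
  have hs : 0 < s := by positivity
  set δ := 1 / (4 * c ^ 3)
  have hc3 : 3 * c ^ 2 + 1 < 4 * c ^ 3 := by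
    nlinarith [sq_nonneg c, mul_pos (sub_pos.2 hc) (sub_pos.2 hc)]
  have hδ : 0 < δ := by positivity
  have hδ3 : δ * (3 * c ^ 2 + 1) < 1 := by
    simp only [δ]; rw [one_div_mul_eq_div, div_lt_one (by positivity)]; exact hc3
  have hδ1 : 0 < 1 - δ := by nlinarith [sq_nonneg c]
  have hosc : HasOscillationBound μ f (fun x r => (⨍ z in ball x r, f z ∂μ) - s / 2) s δ := by
    have := hasOscillationBound_of_bmoNorm_le hμ hfm hs hf
    rwa [show 2 * N / s = δ by simp only [s, δ]; field_simp; norm_num] at this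
  have hδc : δ * (1 + c ^ 2) < 1 := by nlinarith [sq_nonneg c]
  set q := δ * c ^ 2 / (1 - δ)
  have hq0 : 0 ≤ q := by positivity
  have hq : q ≤ Real.exp (-1) := by
    have h1 : q ≤ 1 / 3 := by rw [div_le_iff₀ hδ1]; linarith
    refine h1.trans ?_
    rw [Real.exp_neg, ← one_div]
    exact one_div_le_one_div_of_le (Real.exp_pos 1) (Real.exp_one_lt_d9.le.trans (by norm_num))
  have hexp : 1 / (48 * c ^ 3) * T / N = T / (6 * s) := by simp only [s]; field_simp; norm_num
  rw [hexp]
  rcases lt_or_ge T (6 * s) with hTs | hTs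
  · -- small gaps: the right-hand side is at least `1`
    refine (supMinDensity_le_one hμ _ _).trans ?_
    rw [← ENNReal.ofReal_one]
    refine ENNReal.ofReal_le_ofReal ?_
    rw [mul_assoc, ← Real.exp_add]
    have h1 : T / (6 * s) < 1 := (div_lt_one (by positivity)).2 hTs
    have h2 : 1 ≤ Real.exp (2 + -(T / (6 * s))) := Real.one_le_exp (by linarith)
    nlinarith
  obtain ⟨k, hk⟩ : ∃ k, ⌊T / (6 * s)⌋₊ = k + 1 :=
    Nat.exists_eq_add_one.2 (Nat.floor_pos.2 ((one_le_div (by positivity)).2 hTs))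
  have hk1 : 3 * (k + 1) * s ≤ T / 2 := by
    have h1 := Nat.floor_le (a := T / (6 * s)) (by positivity)
    rw [hk, le_div_iff₀ (by positivity)] at h1
    push_cast at h1
    linarith
  have hk2 : T / (6 * s) - 2 ≤ k := by
    have h1 := Nat.lt_floor_add_one (T / (6 * s))
    rw [hk] at h1
    push_cast at h1
    linarith
  have hck : c * q ^ k ≤ c * Real.exp 2 * Real.exp (-(T / (6 * s))) := by
    rw [mul_assoc, ← Real.exp_add]
    refine mul_le_mul_of_nonneg_left ?_ (by linarith)
    refine (pow_le_pow_left₀ hq0 hq k).trans ?_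
    rw [← Real.exp_nat_mul]
    exact Real.exp_le_exp.2 (by linarith)
  refine (supMinDensity_le_iff hμ).2 fun x r hr => ?_
  -- compare the mean over the doubled ball with the middle of the gap
  rcases le_total (⨍ z in ball x (2 * r), f z ∂μ) (t + T / 2) with h | h
  · right
    refine le_trans (measure_mono ?_) ((hosc.measure_superlevel_le hμ hc hfm hs hδ.le hδc x hr
      k).trans (mul_le_mul_left (ENNReal.ofReal_le_ofReal hck) _))
    rintro y ⟨hy, hyB⟩
    refine ⟨hyB, ?_⟩
    have hy : t + T ≤ f y := hy
    linarith
  · left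
    refine le_trans (measure_mono ?_) ((hosc.neg.measure_superlevel_le hμ hc hfm.neg hs hδ.le hδc x
      hr k).trans (mul_le_mul_left (ENNReal.ofReal_le_ofReal hck) _))
    rintro y ⟨hy, hyB⟩
    refine ⟨hyB, ?_⟩
    have hy : f y ≤ t := hy
    rw [Pi.neg_apply]
    linarith

end JohnNirenberg

/-! ### Paths between two obstacles -/

section Obstacle

open Filter Set Topology

/-- The least majorant of `p` that decreases by at most `A` per step. -/
noncomputable def decayEnvelope (A : ℝ) (p : ℤ → ℝ) (i : ℤ) : ℝ := ⨆ k : ℕ, (p (i - k) - A * k)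

section

variable {A L : ℝ} {p q : ℤ → ℝ}

lemma le_decayEnvelope (hA : 0 ≤ A) (hp : ∀ i, p i ≤ L) (i : ℤ) (k : ℕ) :
    p (i - k) - A * k ≤ decayEnvelope A p i := by
  refine le_ciSup (f := fun k : ℕ => p (i - k) - A * k) ⟨L, ?_⟩ k
  rintro _ ⟨n, rfl⟩
  have : 0 ≤ A * n := by positivity
  linarith [hp (i - n)]

lemma self_le_decayEnvelope (hA : 0 ≤ A) (hp : ∀ i, p i ≤ L) (i : ℤ) :
    p i ≤ decayEnvelope A p i := by
  simpa using le_decayEnvelope hA hp i 0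

lemma decayEnvelope_le {i : ℤ} {w : ℝ} (h : ∀ k : ℕ, p (i - k) - A * k ≤ w) :
    decayEnvelope A p i ≤ w := ciSup_le h

/-- If `p` and `q` grow by at most `A` per step and are nowhere both positive, then their envelopes
are far apart: where one of them is large, the other one needs many steps to become so. -/
lemma decayEnvelope_add_le (hA : 0 ≤ A) (hpL : ∀ i, p i ≤ L) (hqL : ∀ i, q i ≤ L)
    (hp : ∀ i, p (i + 1) ≤ p i + A) (hq : ∀ i, q (i + 1) ≤ q i + A)
    (hpq : ∀ i, p i = 0 ∨ q i = 0) (i : ℤ) : decayEnvelope A p i + decayEnvelope A q i ≤ L := by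
  have growth : ∀ {p : ℤ → ℝ}, (∀ i, p (i + 1) ≤ p i + A) → ∀ (i : ℤ) (n : ℕ),
      p (i + n) ≤ p i + A * n := by
    intro p hp i n
    induction n with
    | zero => simp
    | succ n ih =>
      have := hp (i + n)
      push_cast
      rw [← add_assoc]
      linarith
  have key : ∀ {p q : ℤ → ℝ}, (∀ i, p i ≤ L) → (∀ i, q i ≤ L) → (∀ i, p (i + 1) ≤ p i + A) →
      (∀ i, p i = 0 ∨ q i = 0) → ∀ k l : ℕ, k ≤ l →
        (p (i - k) - A * k) + (q (i - l) - A * l) ≤ L := by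
    intro p q hpL hqL hp hpq k l hkl
    have hk : 0 ≤ A * k := by positivity
    have hl : 0 ≤ A * l := by positivity
    rcases hpq (i - l) with h | h
    · obtain ⟨n, rfl⟩ := Nat.exists_eq_add_of_le hkl
      have h1 := growth hp (i - (k + n : ℕ)) n
      rw [h, show i - ((k + n : ℕ) : ℤ) + n = i - k by push_cast; ring] at h1
      push_cast at h1 hl ⊢
      nlinarith [hqL (i - (k + n : ℤ))]
    · rw [h]
      linarith [hpL (i - k)]
  have h1 : ∀ k l : ℕ, (p (i - k) - A * k) + (q (i - l) - A * l) ≤ L := by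
    intro k l
    rcases le_total k l with h | h
    · exact key hpL hqL hp hpq k l h
    · rw [add_comm]
      exact key hqL hpL hq (fun i => (hpq i).symm) l k h
  have h2 : ∀ l : ℕ, decayEnvelope A p i ≤ L - (q (i - l) - A * l) := fun l =>
    decayEnvelope_le fun k => by linarith [h1 k l]
  have h3 : decayEnvelope A q i ≤ L - decayEnvelope A p i :=
    decayEnvelope_le fun l => by linarith [h2 l]
  linarith

lemma exists_lt_of_lt_decayEnvelope (hA : 0 ≤ A) (hpL : ∀ i, p i ≤ L) {i j : ℤ} (hij : j ≤ i)
    {w : ℝ} (hj : decayEnvelope A p j ≤ w) (hi : w < decayEnvelope A p i) :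
    ∃ l, j < l ∧ w < p l := by
  obtain ⟨k, hk⟩ := exists_lt_of_lt_ciSup hi
  have hAk : 0 ≤ A * k := by positivity
  refine ⟨i - k, ?_, by linarith⟩
  by_contra! hle
  obtain ⟨n, hn⟩ := Int.eq_ofNat_of_zero_le (sub_nonneg.2 hle)
  have h1 := le_decayEnvelope hA hpL j n
  rw [show j - n = i - k by omega] at h1
  have h2 : (n : ℝ) ≤ k := by exact_mod_cast (by omega : (n : ℤ) ≤ k)
  nlinarith

end

/-- The path which starts at scale `-∞` from the lower obstacle `a` and moves only when pushed up by
`a` or down by `u`: formally, the limit of the recursion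
`f (j + 1) = max (a (j + 1)) (min (f j) (u (j + 1)))`, written in closed form. -/
noncomputable def obstaclePath (a u : ℤ → ℝ) (j : ℤ) : ℝ :=
  sSup {v | ∃ i ≤ j, v ≤ a i ∧ ∀ l, i < l → l ≤ j → v ≤ u l}

section

variable {L : ℝ} {a u : ℤ → ℝ}

lemma bddAbove_obstaclePath (ha : ∀ i, a i ≤ L) (j : ℤ) :
    BddAbove {v | ∃ i ≤ j, v ≤ a i ∧ ∀ l, i < l → l ≤ j → v ≤ u l} :=
  ⟨L, fun _ ⟨i, _, h, _⟩ => h.trans (ha i)⟩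

lemma nonempty_obstaclePath (j : ℤ) :
    {v | ∃ i ≤ j, v ≤ a i ∧ ∀ l, i < l → l ≤ j → v ≤ u l}.Nonempty :=
  ⟨a j, j, le_rfl, le_rfl, fun _ h1 h2 => absurd h1 (not_lt.2 h2)⟩

lemma le_obstaclePath (ha : ∀ i, a i ≤ L) (j : ℤ) : a j ≤ obstaclePath a u j :=
  le_csSup (bddAbove_obstaclePath ha j)
    ⟨j, le_rfl, le_rfl, fun _ h1 h2 => absurd h1 (not_lt.2 h2)⟩

lemma obstaclePath_le (hau : ∀ i, a i ≤ u i) (j : ℤ) : obstaclePath a u j ≤ u j := by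
  refine csSup_le (nonempty_obstaclePath j) ?_
  rintro v ⟨i, hij, hv, hu⟩
  rcases hij.eq_or_lt with rfl | h
  · exact hv.trans (hau i)
  · exact hu j h le_rfl

lemma obstaclePath_le_of_forall {j : ℤ} {w : ℝ} (ha : ∀ i, a i ≤ L)
    (hj : obstaclePath a u j ≤ w) (hw : ∀ i, j < i → a i ≤ w) {J : ℤ} (hJ : j ≤ J) :
    obstaclePath a u J ≤ w := by
  refine csSup_le (nonempty_obstaclePath J) ?_
  rintro v ⟨i, hij, hv, hu⟩
  rcases lt_or_ge j i with h | h
  · exact hv.trans (hw i h)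
  · exact (le_csSup (bddAbove_obstaclePath ha j)
      ⟨i, h, hv, fun l h1 h2 => hu l h1 (h2.trans hJ)⟩).trans hj

lemma le_obstaclePath_of_forall {j : ℤ} {w : ℝ} (ha : ∀ i, a i ≤ L)
    (hj : w ≤ obstaclePath a u j) (hw : ∀ i, j < i → w ≤ u i) {J : ℤ} (hJ : j ≤ J) :
    w ≤ obstaclePath a u J := by
  refine le_of_forall_lt fun v hv => ?_
  obtain ⟨v', ⟨i, hi, hv', hu⟩, hlt⟩ := exists_lt_of_lt_csSup (nonempty_obstaclePath j)
    (hv.trans_le hj)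
  obtain ⟨v'', h1, h2⟩ := exists_between (lt_min hv hlt)
  refine h1.trans_le (le_csSup (bddAbove_obstaclePath ha J)
    ⟨i, hi.trans hJ, ?_, fun l hl hlJ => ?_⟩)
  · exact (h2.le.trans (min_le_right _ _)).trans hv'
  · rcases le_or_gt l j with h | h
    · exact (h2.le.trans (min_le_right _ _)).trans (hu l hl h)
    · exact (h2.le.trans (min_le_left _ _)).trans (hw l h)

lemma obstaclePath_le_add {a' u' : ℤ → ℝ} {C : ℝ} {j : ℤ} (ha' : ∀ i, a' i ≤ L)
    (haa : ∀ i ≤ j, a i ≤ a' i + C) (huu : ∀ i ≤ j, u i ≤ u' i + C) :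
    obstaclePath a u j ≤ obstaclePath a' u' j + C := by
  refine csSup_le (nonempty_obstaclePath j) ?_
  rintro v ⟨i, hij, hv, hu⟩
  have := le_csSup (bddAbove_obstaclePath (u := u') ha' j) (a := v - C)
    ⟨i, hij, by linarith [haa i hij], fun l h1 h2 => by linarith [hu l h1 h2, huu l h2]⟩
  unfold obstaclePath at *
  linarith

lemma measurable_obstaclePath {X : Type*} [MeasurableSpace X] {a u : X → ℤ → ℝ}
    (ha : ∀ x i, a x i ≤ L) (ham : ∀ i, Measurable fun x => a x i)
    (hum : ∀ i, Measurable fun x => u x i) (j : ℤ) :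
    Measurable fun x => obstaclePath (a x) (u x) j := by
  refine measurable_of_Ioi fun t => ?_
  have : (fun x => obstaclePath (a x) (u x) j) ⁻¹' Ioi t = ⋃ q : ℚ, ⋃ (_ : t < q), ⋃ i : ℤ,
      ⋃ (_ : i ≤ j), ({x | (q : ℝ) ≤ a x i} ∩ ⋂ l : ℤ, ⋂ (_ : i < l), ⋂ (_ : l ≤ j),
        {x | (q : ℝ) ≤ u x l}) := by
    ext x
    simp only [mem_preimage, mem_Ioi, mem_iUnion, mem_inter_iff, mem_iInter, mem_ofPred_eq,
      exists_prop]
    constructor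
    · intro h
      obtain ⟨v, ⟨i, hi, hv, hu⟩, hlt⟩ := exists_lt_of_lt_csSup (nonempty_obstaclePath j) h
      obtain ⟨q, hq1, hq2⟩ := exists_rat_btwn hlt
      exact ⟨q, hq1, i, hi, hq2.le.trans hv, fun l h1 h2 => hq2.le.trans (hu l h1 h2)⟩
    · rintro ⟨q, hq, i, hi, h1, h2⟩
      exact hq.trans_le (le_csSup (bddAbove_obstaclePath (ha x) j) ⟨i, hi, h1, h2⟩)
  rw [this]
  refine .iUnion fun q => .iUnion fun _ => .iUnion fun i => .iUnion fun _ => .inter ?_ ?_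
  · exact measurableSet_le measurable_const (ham i)
  · exact .iInter fun l => .iInter fun _ => .iInter fun _ =>
      measurableSet_le measurable_const (hum l)

/-- The endpoint of the obstacle path at scale `+∞`. -/
noncomputable def obstacleLimit (a u : ℤ → ℝ) : ℝ :=
  limsup (fun n : ℕ => obstaclePath a u n) atTop

lemma obstacleLimit_le_of_eventually {w w' : ℝ} (hw' : ∀ i, w' ≤ a i) (ha : ∀ i, a i ≤ L)
    {j : ℤ} (h : ∀ J ≥ j, obstaclePath a u J ≤ w) : obstacleLimit a u ≤ w := by
  refine limsup_le_of_le (IsBoundedUnder.isCoboundedUnder_le ⟨w', ?_⟩) ?_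
  · exact eventually_map.2 (Eventually.of_forall fun n => (hw' _).trans (le_obstaclePath ha _))
  · filter_upwards [tendsto_natCast_atTop_atTop.eventually (eventually_ge_atTop j)] with n hn
    exact h n hn

lemma le_obstacleLimit_of_eventually {w w' : ℝ} (hau : ∀ i, a i ≤ u i) (hu : ∀ i, u i ≤ w')
    {j : ℤ} (h : ∀ J ≥ j, w ≤ obstaclePath a u J) : w ≤ obstacleLimit a u := by
  refine le_limsup_of_frequently_le (Eventually.frequently ?_) ⟨w', ?_⟩
  · filter_upwards [tendsto_natCast_atTop_atTop.eventually (eventually_ge_atTop j)] with n hn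
    exact h n hn
  · exact eventually_map.2 (Eventually.of_forall fun n => (obstaclePath_le hau _).trans (hu _))

end

end Obstacle

/-! ### Logarithmic densities -/

section Separation

open Filter Set Topology
open Real (posLog)

variable {X : Type u} [MetricSpace X] [MeasurableSpace X] {c : ℝ} {μ : Measure X}

/-- The truncated logarithm of the relative density of `E` in `B(x, 2⁻ⁱ)`, measured in multiples
of `σ`. It lies in `[0, L]` and vanishes where the density is at most `σ`. -/
noncomputable def logDensity (μ : Measure X) (σ L : ℝ) (E : Set X) (x : X) (i : ℤ) : ℝ :=
  min L (posLog (μ.real (E ∩ ball x (2 ^ (-i))) / μ.real (ball x (2 ^ (-i))) / σ))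

section

variable {σ L : ℝ} {E : Set X}

lemma logDensity_le (x : X) (i : ℤ) : logDensity μ σ L E x i ≤ L := min_le_left _ _

lemma logDensity_nonneg (hL : 0 ≤ L) (x : X) (i : ℤ) : 0 ≤ logDensity μ σ L E x i :=
  le_min hL Real.posLog_nonneg

lemma real_ball_pos (hμ : IsDoublingMeasure c μ) (x : X) {r : ℝ} (hr : 0 < r) :
    0 < μ.real (ball x r) :=
  ENNReal.toReal_pos (hμ.ball_ne_zero x hr) (hμ.ball_ne_top x hr)

lemma logDensity_succ_le (hμ : IsDoublingMeasure c μ) (hc : 1 < c) (hσ : 0 < σ)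
    {x z : X} {i : ℤ} (h : dist x z ≤ 2 ^ (-(i + 1))) :
    logDensity μ σ L E x (i + 1) ≤ logDensity μ σ L E z i + Real.log c := by
  have hlog : 0 ≤ Real.log c := Real.log_nonneg hc.le
  set r : ℝ := 2 ^ (-(i + 1))
  have hr : 0 < r := by positivity
  have hr2 : (2 : ℝ) ^ (-i) = 2 * r := by
    simp only [r]
    rw [show -i = -(i + 1) + 1 by ring, zpow_add_one₀ two_ne_zero, mul_comm]
  have hsub : ball x r ⊆ ball z (2 * r) := ball_subset_ball' (by linarith)
  have h1 : μ.real (ball z (2 * r)) ≤ c * μ.real (ball x r) := by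
    have := hμ.doubling z x r hr ⟨x, hsub (mem_ball_self hr), mem_ball_self hr⟩
    have h2 := ENNReal.toReal_mono (ENNReal.mul_ne_top (by simp) (hμ.ball_ne_top x hr)) this
    rwa [ENNReal.toReal_mul, ENNReal.toReal_ofReal (by linarith)] at h2
  have h2 : μ.real (E ∩ ball x r) ≤ μ.real (E ∩ ball z (2 * r)) :=
    measureReal_mono (inter_subset_inter_right _ hsub)
      (ne_top_of_le_ne_top (hμ.ball_ne_top z (by positivity)) (measure_mono inter_subset_right))
  have h3 := real_ball_pos hμ x hr
  have h4 := real_ball_pos hμ z (r := 2 * r) (by positivity)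
  have h5 : μ.real (E ∩ ball x r) / μ.real (ball x r) / σ ≤
      c * (μ.real (E ∩ ball z (2 * r)) / μ.real (ball z (2 * r)) / σ) := by
    rw [← mul_div_assoc, div_le_div_iff_of_pos_right hσ, ← mul_div_assoc, div_le_div_iff₀ h3 h4]
    calc _ ≤ μ.real (E ∩ ball z (2 * r)) * (c * μ.real (ball x r)) :=
          mul_le_mul h2 h1 h4.le measureReal_nonneg
      _ = _ := by ring
  have h6 := (Real.posLog_le_posLog (by positivity) h5).trans Real.posLog_mul
  rw [Real.posLog_eq_log (x := c) (hc.le.trans (le_abs_self c))] at h6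
  unfold logDensity
  rw [hr2]
  rcases le_total L (posLog (μ.real (E ∩ ball z (2 * r)) / μ.real (ball z (2 * r)) / σ)) with h | h
  · rw [min_eq_left h]
    exact (min_le_left _ _).trans (by linarith)
  · rw [min_eq_right h]
    exact (min_le_right _ _).trans (by linarith)

lemma logDensity_eq_zero (hμ : IsDoublingMeasure c μ) (hσ : 0 < σ) (hL : 0 ≤ L) {x : X} {i : ℤ}
    (h : μ (E ∩ ball x (2 ^ (-i))) ≤ ENNReal.ofReal σ * μ (ball x (2 ^ (-i)))) :
    logDensity μ σ L E x i = 0 := by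
  have hr : (0 : ℝ) < 2 ^ (-i) := by positivity
  have h1 : μ.real (E ∩ ball x (2 ^ (-i))) ≤ σ * μ.real (ball x (2 ^ (-i))) := by
    have h2 := ENNReal.toReal_mono (ENNReal.mul_ne_top (by simp) (hμ.ball_ne_top x hr)) h
    rwa [ENNReal.toReal_mul, ENNReal.toReal_ofReal hσ.le] at h2
  have h3 : posLog (μ.real (E ∩ ball x (2 ^ (-i))) / μ.real (ball x (2 ^ (-i))) / σ) = 0 := by
    rw [Real.posLog_eq_zero_iff, abs_of_nonneg (by positivity), div_le_one hσ,
      div_le_iff₀ (real_ball_pos hμ x hr)]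
    exact h1
  rw [logDensity, h3, min_eq_right hL]

variable [BorelSpace X]

lemma measurable_logDensity (hμ : IsDoublingMeasure c μ) (i : ℤ) :
    Measurable fun x => logDensity μ σ L E x i := by
  have := hμ.secondCountableTopology
  have := hμ.sigmaFinite
  have key : ∀ (ν : Measure X) [SFinite ν] (r : ℝ), Measurable fun x => ν.real (ball x r) := by
    intro ν _ r
    have hS : MeasurableSet {p : X × X | dist p.2 p.1 < r} :=
      (isOpen_lt (continuous_snd.dist continuous_fst) continuous_const).measurableSet
    exact (measurable_measure_prodMk_left (ν := ν) hS).ennreal_toReal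
  have h1 := key (μ.restrict E) (2 ^ (-i))
  have h2 : ∀ x, (μ.restrict E).real (ball x (2 ^ (-i))) = μ.real (E ∩ ball x (2 ^ (-i))) := by
    intro x
    rw [measureReal_restrict_apply measurableSet_ball, inter_comm]
  simp only [h2] at h1
  have h3 : Measurable (posLog) := by
    rw [Real.posLog_def]
    exact measurable_const.max Real.measurable_log
  exact measurable_const.min (h3.comp ((h1.div (key μ _)).div_const σ))

/-- Around a density point of `E` the density eventually exceeds `1 / 2`, and the truncation height
is attained. -/
lemma ae_eventually_logDensity_eq (hμ : IsDoublingMeasure c μ) (hc : 1 < c) (hσ : 0 < σ)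
    (hLσ : L ≤ Real.log (1 / (2 * σ))) (hE : NullMeasurableSet E μ) :
    ∀ᵐ x ∂μ, x ∈ E → ∃ j : ℤ, ∀ i ≥ j, logDensity μ σ L E x i = L := by
  filter_upwards [hμ.ae_eventually_measure_diff_le hc hE] with x hx hxE
  have h1 := hx hxE (1 / 2) (by norm_num)
  obtain ⟨ε, hε, hsub⟩ := mem_nhdsGT_iff_exists_Ioc_subset.1 h1
  have hε : 0 < ε := hε
  obtain ⟨n, hn⟩ := exists_pow_lt_of_lt_one hε (show (1 / 2 : ℝ) < 1 by norm_num)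
  refine ⟨n, fun i hi => min_eq_left ?_⟩
  have hr : (0 : ℝ) < 2 ^ (-i) := by positivity
  have hrε : (2 : ℝ) ^ (-i) ≤ ε := by
    calc (2 : ℝ) ^ (-i) ≤ 2 ^ (-(n : ℤ)) := zpow_le_zpow_right₀ one_le_two (by omega)
      _ = (1 / 2) ^ n := by simp
      _ ≤ ε := hn.le
  have h2 : μ (ball x (2 ^ (-i)) \ E) ≤ ENNReal.ofReal (1 / 2) * μ (ball x (2 ^ (-i))) :=
    hsub ⟨hr, hrε⟩
  have hB := real_ball_pos hμ x hr
  have h3 : μ.real (ball x (2 ^ (-i)) \ E) ≤ 1 / 2 * μ.real (ball x (2 ^ (-i))) := by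
    have := ENNReal.toReal_mono (ENNReal.mul_ne_top (by simp) (hμ.ball_ne_top x hr)) h2
    rwa [ENNReal.toReal_mul, ENNReal.toReal_ofReal (by norm_num)] at this
  have h4 : μ.real (E ∩ ball x (2 ^ (-i))) + μ.real (ball x (2 ^ (-i)) \ E) =
      μ.real (ball x (2 ^ (-i))) := by
    rw [inter_comm]
    exact measureReal_inter_add_sdiff₀ hE (hμ.ball_ne_top x hr)
  have h5 : 1 / (2 * σ) ≤ μ.real (E ∩ ball x (2 ^ (-i))) / μ.real (ball x (2 ^ (-i))) / σ := by
    rw [← div_div, div_le_div_iff_of_pos_right hσ, le_div_iff₀ hB]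
    linarith
  refine hLσ.trans ((Real.log_le_log (by positivity) h5).trans ?_)
  exact le_max_right _ _

/-- Maximal function estimate: the points around which `E` is, at some smaller scale, denser by a
factor `eᵗ` than at the scale of the ball `B(z, r)` itself form an exponentially small part of that
ball. -/
lemma measure_exists_logDensity_gt_le (hμ : IsDoublingMeasure c μ) (hc : 1 < c) (hσ : 0 < σ)
    (hL : 0 ≤ L) (z : X) {r t w : ℝ} (hr : 0 < r) (ht : 0 ≤ t) {j : ℤ} (hj1 : 2 * r ≤ 2 ^ (-j))
    (hj2 : (2 : ℝ) ^ (-j) ≤ 4 * r) (hz : logDensity μ σ L E z j ≤ w - t) :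
    μ {x ∈ ball z r | ∃ i, j < i ∧ w < logDensity μ σ L E x i} ≤
      ENNReal.ofReal (c ^ 4 * Real.exp (-t)) * μ (ball z r) := by
  have hw : 0 ≤ w := by linarith [logDensity_nonneg (μ := μ) (σ := σ) (E := E) hL z j]
  rcases le_or_gt L w with hLw | hLw
  · -- the truncation at height `L` leaves no such points
    have : {x ∈ ball z r | ∃ i, j < i ∧ w < logDensity μ σ L E x i} = ∅ :=
      eq_empty_of_forall_notMem fun x ⟨_, i, _, h⟩ =>
        absurd h (not_lt.2 ((logDensity_le x i).trans hLw))
    rw [this]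
    simp
  set A := {x ∈ ball z r | ∃ i, j < i ∧ w < logDensity μ σ L E x i}
  have hex : ∀ x, ∃ i, x ∈ A → j < i ∧ w < logDensity μ σ L E x i := fun x => by
    by_cases h : x ∈ A
    · obtain ⟨i, hi⟩ := h.2
      exact ⟨i, fun _ => hi⟩
    · exact ⟨0, fun h' => absurd h' h⟩
  choose i hi using hex
  have hρ : ∀ x, (0 : ℝ) < 2 ^ (-i x) := fun x => by positivity
  have hR : (0 : ℝ) < 2 ^ (-j) := by positivity
  have hρj : ∀ x ∈ A, (2 : ℝ) ^ (-i x) ≤ 2 ^ (-j) / 2 := fun x hx => by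
    rw [div_eq_mul_inv, ← zpow_sub_one₀ two_ne_zero]
    exact zpow_le_zpow_right₀ one_le_two (by have := (hi x hx).1; omega)
  have hsub : ∀ x ∈ A, ball x (2 ^ (-i x)) ⊆ ball z (2 ^ (-j)) := fun x hx =>
    ball_subset_ball' (by have := hρj x hx; have h2 := mem_ball.1 hx.1; linarith)
  have hdz : μ (E ∩ ball z (2 ^ (-j))) ≤
      ENNReal.ofReal (σ * Real.exp (w - t)) * μ (ball z (2 ^ (-j))) := by
    have h1 : posLog (μ.real (E ∩ ball z (2 ^ (-j))) / μ.real (ball z (2 ^ (-j))) / σ) ≤ w - t := by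
      rcases min_le_iff.1 hz with h | h
      · linarith
      · exact h
    have hB := real_ball_pos hμ z hR
    have h2 : μ.real (E ∩ ball z (2 ^ (-j))) ≤
        σ * Real.exp (w - t) * μ.real (ball z (2 ^ (-j))) := by
      rcases (measureReal_nonneg (μ := μ) (s := E ∩ ball z (2 ^ (-j)))).eq_or_lt with h0 | h0
      · rw [← h0]; positivity
      · have h3 := (le_max_right _ _).trans h1
        rw [Real.log_le_iff_le_exp (by positivity), div_div, div_le_iff₀ (by positivity)] at h3
        linarith
    have hEt : μ (E ∩ ball z (2 ^ (-j))) ≠ ∞ :=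
      ne_top_of_le_ne_top (hμ.ball_ne_top z hR) (measure_mono inter_subset_right)
    rw [← ENNReal.ofReal_toReal hEt, ← ENNReal.ofReal_toReal (hμ.ball_ne_top z hR),
      ← ENNReal.ofReal_mul (by positivity)]
    exact ENNReal.ofReal_le_ofReal h2
  have hdx : ∀ x ∈ A, ENNReal.ofReal (σ * Real.exp w) * μ (ball x (2 ^ (-i x))) ≤
      μ (E ∩ ball x (2 ^ (-i x))) := by
    intro x hx
    have hB := real_ball_pos hμ x (hρ x)
    have h1 : w < posLog (μ.real (E ∩ ball x (2 ^ (-i x))) / μ.real (ball x (2 ^ (-i x))) / σ) :=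
      (hi x hx).2.trans_le (min_le_right _ _)
    have h2 : w < Real.log
        (μ.real (E ∩ ball x (2 ^ (-i x))) / μ.real (ball x (2 ^ (-i x))) / σ) := by
      rcases lt_max_iff.1 h1 with h | h
      · linarith
      · exact h
    have h3 : 0 < μ.real (E ∩ ball x (2 ^ (-i x))) := by
      refine (measureReal_nonneg (μ := μ)).lt_of_ne fun h0 => ?_
      rw [← h0] at h2
      simp at h2
      linarith
    rw [Real.lt_log_iff_exp_lt (by positivity), div_div, lt_div_iff₀ (by positivity)] at h2
    have hEt : μ (E ∩ ball x (2 ^ (-i x))) ≠ ∞ :=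
      ne_top_of_le_ne_top (hμ.ball_ne_top x (hρ x)) (measure_mono inter_subset_right)
    rw [← ENNReal.ofReal_toReal hEt, ← ENNReal.ofReal_toReal (hμ.ball_ne_top x (hρ x)),
      ← ENNReal.ofReal_mul (by positivity)]
    exact ENNReal.ofReal_le_ofReal (by
      calc _ = Real.exp w * (μ.real (ball x (2 ^ (-i x))) * σ) := by
            rw [measureReal_def]; ring
        _ ≤ _ := h2.le)
  have hcov : μ A ≤ ENNReal.ofReal (c ^ 2 / (σ * Real.exp w)) * μ (E ∩ ball z (2 ^ (-j))) := by
    refine hμ.measure_le_mul_of_forall_ball (R := 2 ^ (-j) / 2) (fun x => 2 ^ (-i x))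
      (fun x _ => hρ x) hρj fun x hx => ?_
    calc μ (A ∩ ball x (4 * 2 ^ (-i x))) ≤ μ (ball x (4 * 2 ^ (-i x))) :=
          measure_mono inter_subset_right
      _ ≤ ENNReal.ofReal (c ^ 2) * μ (ball x (2 ^ (-i x))) := hμ.measure_ball_four_le hc x (hρ x)
      _ = ENNReal.ofReal (c ^ 2 / (σ * Real.exp w)) *
          (ENNReal.ofReal (σ * Real.exp w) * μ (ball x (2 ^ (-i x)))) := by
          rw [← mul_assoc, ← ENNReal.ofReal_mul (by positivity),
            div_mul_cancel₀ _ (by positivity)]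
      _ ≤ ENNReal.ofReal (c ^ 2 / (σ * Real.exp w)) * μ (E ∩ ball x (2 ^ (-i x))) :=
          mul_le_mul_right (hdx x hx) _
      _ ≤ _ := by
          refine mul_le_mul_right (measure_mono ?_) _
          exact fun y hy => ⟨⟨hy.1, hsub x hx hy.2⟩, hy.2⟩
  have hbig : μ (ball z (2 ^ (-j))) ≤ ENNReal.ofReal (c ^ 2) * μ (ball z r) :=
    (measure_mono (ball_subset_ball hj2)).trans (hμ.measure_ball_four_le hc z hr)
  calc μ A ≤ _ := hcov
    _ ≤ ENNReal.ofReal (c ^ 2 / (σ * Real.exp w)) * (ENNReal.ofReal (σ * Real.exp (w - t)) *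
        (ENNReal.ofReal (c ^ 2) * μ (ball z r))) := by gcongr; exact hdz.trans (by gcongr)
    _ = _ := by
        rw [← mul_assoc, ← mul_assoc, ← ENNReal.ofReal_mul (by positivity),
          ← ENNReal.ofReal_mul (by positivity)]
        congr 2
        rw [sub_eq_add_neg, Real.exp_add]
        field_simp

end

end Separation

/-! ### Functions separating two sets -/

section SeparatingFunction

open Filter Set Topology

lemma bmoNorm_const_mul {X : Type u} [MetricSpace X] [MeasurableSpace X] {μ : Measure X}
    (f : X → ℝ) (a : ℝ) : bmoNorm μ (fun x => a * f x) = ‖a‖ₑ * bmoNorm μ f := by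
  simp only [bmoNorm, ENNReal.mul_iSup]
  refine iSup_congr fun x => iSup_congr fun r => iSup_congr fun _ => ?_
  rw [← mul_div_assoc, ← lintegral_const_mul' _ _ (by simp)]
  congr 2
  ext y
  rw [← enorm_mul, mul_sub, setAverage_eq, setAverage_eq, integral_const_mul]
  simp only [smul_eq_mul]
  ring_nf

lemma MemBMO.const_mul {X : Type u} [MetricSpace X] [MeasurableSpace X] {μ : Measure X}
    {f : X → ℝ} (hf : MemBMO μ f) (a : ℝ) : MemBMO μ (fun x => a * f x) :=
  ⟨hf.1.smul a, by rw [bmoNorm_const_mul]; exact ENNReal.mul_lt_top (by simp) hf.2⟩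

/-- Two sets of small joint density are separated by a function of bounded `BMO` norm whose
values on them differ by the logarithm of the joint density. On dyadic scales decreasing to `0`, the
function follows the obstacle path between the envelopes of the logarithmic densities of `E₂`, from
below, and of `E₁`, from above. -/
lemma exists_memBMO_log_separating {c : ℝ} (hc : 1 < c) : ∃ C : ℝ, 0 < C ∧
    ∀ (X : Type u) [MetricSpace X] [MeasurableSpace X] [BorelSpace X] (μ : Measure X),
      IsDoublingMeasure c μ → ∀ (E₁ E₂ : Set X) (σ : ℝ), NullMeasurableSet E₁ μ →
        NullMeasurableSet E₂ μ → 0 < σ → σ < 1 / 2 → supMinDensity μ E₁ E₂ ≤ ENNReal.ofReal σ →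
          ∃ f : X → ℝ, MemBMO μ f ∧ bmoNorm μ f ≤ ENNReal.ofReal C ∧
            (∀ᵐ x ∂μ, x ∈ E₁ → f x ≤ 0) ∧
              ∀ᵐ x ∂μ, x ∈ E₂ → Real.log (1 / (2 * σ)) ≤ f x := by
  set δ := 1 / (4 * c ^ 3)
  have hδ : 0 < δ := by positivity
  have hδ3 : δ * (3 * c ^ 2 + 1) < 1 := by
    simp only [δ]; rw [one_div_mul_eq_div, div_lt_one (by positivity)]
    nlinarith [sq_nonneg c, mul_pos (sub_pos.2 hc) (sub_pos.2 hc)]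
  have hδ1 : 0 < 1 - δ := by nlinarith [sq_nonneg c]
  have hδc : δ * (1 + c ^ 2) < 1 := by nlinarith [sq_nonneg c]
  have hq1 : 0 < 1 - δ * c ^ 2 / (1 - δ) := by
    rw [sub_pos, div_lt_one hδ1]; linarith
  set A := Real.log c
  have hA : 0 < A := Real.log_pos hc
  -- at this height the two exponential tails together have relative measure `δ`
  set t₀ := Real.log (8 * c ^ 7)
  have ht₀ : 0 < t₀ := Real.log_pos (by
    have := one_le_pow₀ hc.le (n := 7)
    linarith)
  have htail : c ^ 4 * Real.exp (-t₀) + c ^ 4 * Real.exp (-t₀) = δ := by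
    simp only [t₀, δ]
    rw [Real.exp_neg, Real.exp_log (by positivity)]
    field_simp
    norm_num
  refine ⟨6 * (1 + 2 * c * (1 - δ * c ^ 2 / (1 - δ))⁻¹) * (2 * (2 * A + t₀)), by positivity, ?_⟩
  intro X _ _ _ μ hμ E₁ E₂ σ hE₁ hE₂ hσ hσ2 hS
  -- the factor `2` makes density `1 / 2`, which density points do reach, count as full
  set L := Real.log (1 / (2 * σ))
  have hL : 0 ≤ L := Real.log_nonneg (by rw [le_div_iff₀ (by positivity)]; linarith)
  let p : X → ℤ → ℝ := logDensity μ σ L E₂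
  let q : X → ℤ → ℝ := logDensity μ σ L E₁
  let a : X → ℤ → ℝ := fun x => decayEnvelope A (p x)
  let b : X → ℤ → ℝ := fun x => decayEnvelope A (q x)
  let u : X → ℤ → ℝ := fun x i => L - b x i
  let f : X → ℝ := fun x => obstacleLimit (a x) (u x)
  have hpL : ∀ x i, p x i ≤ L := fun x i => logDensity_le x i
  have hqL : ∀ x i, q x i ≤ L := fun x i => logDensity_le x i
  have hpa : ∀ x i, p x i ≤ a x i := fun x i => self_le_decayEnvelope hA.le (hpL x) i
  have hqb : ∀ x i, q x i ≤ b x i := fun x i => self_le_decayEnvelope hA.le (hqL x) i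
  have ha0 : ∀ x i, 0 ≤ a x i := fun x i => (logDensity_nonneg hL x i).trans (hpa x i)
  have hb0 : ∀ x i, 0 ≤ b x i := fun x i => (logDensity_nonneg hL x i).trans (hqb x i)
  have hpq : ∀ x i, p x i = 0 ∨ q x i = 0 := by
    intro x i
    rcases (supMinDensity_le_iff hμ).1 hS x (2 ^ (-i)) (by positivity) with h | h
    · exact Or.inr (logDensity_eq_zero hμ hσ hL h)
    · exact Or.inl (logDensity_eq_zero hμ hσ hL h)
  have hab : ∀ x i, a x i + b x i ≤ L := fun x i =>
    decayEnvelope_add_le hA.le (hpL x) (hqL x)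
      (fun i => logDensity_succ_le hμ hc hσ (by rw [dist_self]; positivity))
      (fun i => logDensity_succ_le hμ hc hσ (by rw [dist_self]; positivity)) (hpq x) i
  have hau : ∀ x i, a x i ≤ u x i := fun x i => by have := hab x i; simp only [u]; linarith
  have haL : ∀ x i, a x i ≤ L := fun x i => by linarith [hab x i, hb0 x i]
  have huL : ∀ x i, u x i ≤ L := fun x i => by have := hb0 x i; simp only [u]; linarith
  -- at distance below the scale, the envelopes change by a bounded amount
  have henv : ∀ (E : Set X) (x z : X) (i : ℤ), dist x z ≤ 2 ^ (-i) →
      decayEnvelope A (logDensity μ σ L E x) i ≤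
        decayEnvelope A (logDensity μ σ L E z) i + 2 * A := by
    intro E x z i hxz
    refine decayEnvelope_le fun k => ?_
    have h1 : logDensity μ σ L E x (i - k) ≤ logDensity μ σ L E z (i - (k + 1 : ℕ)) + A := by
      have h2 := logDensity_succ_le (L := L) (E := E) hμ hc hσ (x := x) (z := z)
        (i := i - (k + 1 : ℕ)) (hxz.trans (zpow_le_zpow_right₀ one_le_two (by push_cast; omega)))
      rwa [show i - ((k + 1 : ℕ) : ℤ) + 1 = i - k by push_cast; ring] at h2
    have h3 := le_decayEnvelope hA.le (fun i => logDensity_le (μ := μ) (σ := σ) (L := L) (E := E)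
      z i) i (k + 1)
    push_cast at h1 h3
    linarith
  have hpath : ∀ (x z : X) (j : ℤ), dist x z ≤ 2 ^ (-j) →
      obstaclePath (a x) (u x) j ≤ obstaclePath (a z) (u z) j + 2 * A := by
    intro x z j hxz
    have hle : ∀ i ≤ j, dist x z ≤ 2 ^ (-i) := fun i hi =>
      hxz.trans (zpow_le_zpow_right₀ one_le_two (by omega))
    refine obstaclePath_le_add (haL z) (fun i hi => henv E₂ x z i (hle i hi)) fun i hi => ?_
    have := henv E₁ z x i (by rw [dist_comm]; exact hle i hi)
    simp only [u, b, q]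
    linarith
  have hfm : Measurable f := by
    have h1 : ∀ i, Measurable fun x => a x i := fun i => .iSup fun k =>
      (measurable_logDensity hμ _).sub_const _
    have h2 : ∀ i, Measurable fun x => u x i := fun i => measurable_const.sub (.iSup fun k =>
      (measurable_logDensity hμ _).sub_const _)
    exact .limsup fun n => measurable_obstaclePath haL h1 h2 n
  have hscale : ∀ r : ℝ, ∃ j : ℤ, 0 < r → 2 * r ≤ 2 ^ (-j) ∧ (2 : ℝ) ^ (-j) ≤ 4 * r := by
    intro r
    by_cases hr : 0 < r
    · obtain ⟨n, hn1, hn2⟩ := exists_mem_Ioc_zpow (x := 2 * r) (by positivity) one_lt_two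
      refine ⟨-(n + 1), fun _ => ⟨by rwa [neg_neg], ?_⟩⟩
      rw [neg_neg, zpow_add_one₀ two_ne_zero]
      linarith
    · exact ⟨0, fun h => absurd h hr⟩
  choose j hj using hscale
  let v : X → ℝ → ℝ := fun z r => obstaclePath (a z) (u z) (j r)
  have hosc : HasOscillationBound μ f (fun z r => v z r - (2 * A + t₀)) (2 * (2 * A + t₀)) δ := by
    intro z r hr
    obtain ⟨hj1, hj2⟩ := hj r hr
    have hdist : ∀ x ∈ ball z r, dist x z ≤ 2 ^ (-j r) := fun x hx =>
      (mem_ball.1 hx).le.trans (by linarith)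
    have hup := measure_exists_logDensity_gt_le (E := E₂) hμ hc hσ hL z hr ht₀.le hj1 hj2
      (w := v z r + 2 * A + t₀) (by
        have h1 : p z (j r) ≤ v z r := (hpa z (j r)).trans (le_obstaclePath (haL z) (j r))
        simp only [p] at h1
        linarith)
    have hdown := measure_exists_logDensity_gt_le (E := E₁) hμ hc hσ hL z hr ht₀.le hj1 hj2
      (w := L - v z r + 2 * A + t₀) (by
        have h1 : v z r ≤ L - b z (j r) := obstaclePath_le (hau z) (j r)
        have h2 : q z (j r) ≤ b z (j r) := hqb z (j r)
        simp only [q] at h2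
        linarith)
    refine (measure_mono ?_).trans
      ((measure_union_le _ _).trans ((add_le_add hup hdown).trans_eq ?_))
    · rintro x ⟨hx, h | h⟩
      · -- the path falls below its value at scale `j r` only if it meets the upper obstacle
        right
        refine ⟨hx, ?_⟩
        have h1 : v z r - 2 * A ≤ obstaclePath (a x) (u x) (j r) := by
          have := hpath z x (j r) (by rw [dist_comm]; exact hdist x hx)
          simp only [v]
          linarith
        obtain ⟨i, hi, hlt⟩ : ∃ i, j r < i ∧ u x i < v z r - 2 * A - t₀ := by
          by_contra! hcon
          have h2 : v z r - 2 * A - t₀ ≤ f x := le_obstacleLimit_of_eventually (hau x) (huL x)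
            fun J hJ => le_obstaclePath_of_forall (haL x) (by linarith) hcon hJ
          linarith
        refine exists_lt_of_lt_decayEnvelope hA.le (hqL x) hi.le ?_
          (show _ < b x i by simp only [u] at hlt; linarith)
        have h3 : obstaclePath (a x) (u x) (j r) ≤ L - b x (j r) := obstaclePath_le (hau x) (j r)
        simp only [b] at h3
        linarith
      · left
        refine ⟨hx, ?_⟩
        have h1 : obstaclePath (a x) (u x) (j r) ≤ v z r + 2 * A := hpath x z (j r) (hdist x hx)
        obtain ⟨i, hi, hlt⟩ : ∃ i, j r < i ∧ v z r + 2 * A + t₀ < a x i := by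
          by_contra! hcon
          have h2 : f x ≤ v z r + 2 * A + t₀ := obstacleLimit_le_of_eventually (ha0 x) (haL x)
            fun J hJ => obstaclePath_le_of_forall (haL x) (by linarith) hcon hJ
          linarith
        exact exists_lt_of_lt_decayEnvelope hA.le (hpL x) hi.le
          ((le_obstaclePath (haL x) (j r)).trans (by linarith)) hlt
    · rw [← add_mul, ← ENNReal.ofReal_add (by positivity) (by positivity), htail]
  obtain ⟨hf, hfC⟩ := hosc.memBMO hμ hc hfm.aemeasurable (by positivity) hδ.le hδc
  refine ⟨f, hf, hfC, ?_, ?_⟩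
  · filter_upwards [ae_eventually_logDensity_eq hμ hc hσ le_rfl hE₁] with x hx hxE
    obtain ⟨J, hJ⟩ := hx hxE
    refine obstacleLimit_le_of_eventually (ha0 x) (haL x) (j := J) fun i hi => ?_
    have h1 : obstaclePath (a x) (u x) i ≤ L - b x i := obstaclePath_le (hau x) i
    have h2 : q x i ≤ b x i := hqb x i
    have h3 : q x i = L := hJ i hi
    linarith
  · filter_upwards [ae_eventually_logDensity_eq hμ hc hσ le_rfl hE₂] with x hx hxE
    obtain ⟨J, hJ⟩ := hx hxE
    refine le_obstacleLimit_of_eventually (hau x) (huL x) (j := J) fun i hi => ?_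
    have h1 := le_obstaclePath (u := u x) (haL x) i
    have h2 : p x i ≤ a x i := hpa x i
    have h3 : p x i = L := hJ i hi
    linarith

/-- Sets of joint density less than `1` are essentially disjoint. -/
lemma ae_notMem_of_supMinDensity_lt_one {X : Type u} [MetricSpace X] [MeasurableSpace X]
    [BorelSpace X] {c : ℝ} {μ : Measure X} (hμ : IsDoublingMeasure c μ) (hc : 1 < c)
    {E₁ E₂ : Set X} (hE₁ : NullMeasurableSet E₁ μ) (hE₂ : NullMeasurableSet E₂ μ) {σ : ℝ}
    (hσ0 : 0 ≤ σ) (hσ : σ < 1) (hS : supMinDensity μ E₁ E₂ ≤ ENNReal.ofReal σ) :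
    ∀ᵐ x ∂μ, x ∈ E₁ → x ∉ E₂ := by
  filter_upwards [hμ.ae_eventually_measure_diff_le hc (hE₁.inter hE₂)] with x hx h1 h2
  obtain ⟨r, hr, hr0⟩ :=
    ((hx ⟨h1, h2⟩ ((1 - σ) / 2) (by linarith)).and self_mem_nhdsWithin).exists
  have hr0 : 0 < r := hr0
  have key : ∀ E : Set X, E₁ ∩ E₂ ⊆ E →
      ¬ μ (E ∩ ball x r) ≤ ENNReal.ofReal σ * μ (ball x r) := by
    intro E hE hle
    have h3 : μ (ball x r) ≤ ENNReal.ofReal (σ + (1 - σ) / 2) * μ (ball x r) := by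
      rw [ENNReal.ofReal_add hσ0 (by linarith), add_mul]
      refine le_trans (measure_mono fun y hy => ?_) ((measure_union_le (E ∩ ball x r)
        (ball x r \ (E₁ ∩ E₂))).trans (add_le_add hle hr))
      by_cases hyE : y ∈ E₁ ∩ E₂
      · exact Or.inl ⟨hE hyE, hy⟩
      · exact Or.inr ⟨hy, hyE⟩
    have h4 := (ENNReal.mul_lt_mul_iff_left (hμ.ball_ne_zero x hr0) (hμ.ball_ne_top x hr0)).2
      (ENNReal.ofReal_lt_one.2 (by linarith : σ + (1 - σ) / 2 < 1))
    rw [one_mul] at h4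
    exact absurd h3 (not_le.2 h4)
  rcases (supMinDensity_le_iff hμ).1 hS x r hr0 with h | h
  · exact key E₁ inter_subset_left h
  · exact key E₂ inter_subset_right h

/-- The separating function, normalized to the values `0` and `1`. For joint densities which are
not small, the indicator of `E₂` does. -/
lemma exists_memBMO_separating {c : ℝ} (hc : 1 < c) : ∃ C : ℝ, 0 < C ∧
    ∀ (X : Type u) [MetricSpace X] [MeasurableSpace X] [BorelSpace X] (μ : Measure X),
      IsDoublingMeasure c μ → ∀ (E₁ E₂ : Set X) (σ : ℝ), NullMeasurableSet E₁ μ →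
        NullMeasurableSet E₂ μ → 0 < σ → σ < 1 → supMinDensity μ E₁ E₂ ≤ ENNReal.ofReal σ →
          ∃ f : X → ℝ, MemBMO μ f ∧ bmoNorm μ f ≤ ENNReal.ofReal (C / Real.log (1 / σ)) ∧
            (∀ᵐ x ∂μ, x ∈ E₁ → f x ≤ 0) ∧ ∀ᵐ x ∂μ, x ∈ E₂ → 1 ≤ f x := by
  obtain ⟨C, hC, h⟩ := exists_memBMO_log_separating.{u} hc
  obtain ⟨C', hC', h'⟩ := exists_bmoNorm_le_of_levelSetsSeparated.{u} hc le_rfl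
    (by positivity : (0 : ℝ) < 1 / (4 * c ^ 3))
  refine ⟨max (2 * C) (C' * Real.log 4), by positivity, ?_⟩
  intro X _ _ _ μ hμ E₁ E₂ σ hE₁ hE₂ hσ hσ1 hS
  have hlog : 0 < Real.log (1 / σ) := Real.log_pos (by rwa [one_lt_div hσ])
  rcases lt_or_ge σ (1 / 4) with hσ4 | hσ4
  · obtain ⟨f, hf, hfC, hf1, hf2⟩ := h X μ hμ E₁ E₂ σ hE₁ hE₂ hσ (by linarith) hS
    set L := Real.log (1 / (2 * σ))
    have hL : Real.log (1 / σ) ≤ 2 * L := by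
      have h1 : 2 * L = Real.log ((1 / (2 * σ)) ^ 2) := by
        rw [Real.log_pow, Nat.cast_ofNat]
      rw [h1]
      refine Real.log_le_log (by positivity) ?_
      rw [div_pow, div_le_div_iff₀ hσ (by positivity)]
      nlinarith
    have hL0 : 0 < L := by linarith
    refine ⟨fun x => L⁻¹ * f x, hf.const_mul _, ?_, ?_, ?_⟩
    · rw [bmoNorm_const_mul, Real.enorm_eq_ofReal (by positivity)]
      refine (mul_le_mul_right hfC _).trans ?_
      rw [← ENNReal.ofReal_mul (by positivity)]
      refine ENNReal.ofReal_le_ofReal ?_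
      rw [inv_mul_eq_div, div_le_div_iff₀ hL0 hlog]
      nlinarith [le_max_left (2 * C) (C' * Real.log 4)]
    · filter_upwards [hf1] with x hx hxE
      exact mul_nonpos_of_nonneg_of_nonpos (by positivity) (hx hxE)
    · filter_upwards [hf2] with x hx hxE
      rw [inv_mul_eq_div, one_le_div hL0]
      exact hx hxE
  · obtain ⟨hf, hfC⟩ := h' X μ hμ (E₂.indicator fun _ => (1 : ℝ)) 1
      (aemeasurable_const.indicator₀ hE₂) one_pos (by
        intro t
        refine (supMinDensity_le_iff hμ).2 fun x r hr => ?_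
        rcases le_or_gt t 0 with ht | ht
        · left
          have : {y | E₂.indicator (fun _ => (1 : ℝ)) y < t} = ∅ :=
            eq_empty_of_forall_notMem fun y hy =>
              absurd (hy.trans_le ht) (not_lt.2 (indicator_nonneg (fun _ _ => zero_le_one) y))
          simp [this]
        · right
          have : {y | t + 1 < E₂.indicator (fun _ => (1 : ℝ)) y} = ∅ :=
            eq_empty_of_forall_notMem fun y hy => by
              have h1 : t + 1 < E₂.indicator (fun _ => (1 : ℝ)) y := hy
              have h2 : E₂.indicator (fun _ => (1 : ℝ)) y ≤ 1 :=
                indicator_le_self' (fun _ _ => zero_le_one) y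
              linarith
          simp [this])
    refine ⟨_, hf, hfC.trans (ENNReal.ofReal_le_ofReal ?_), ?_, ?_⟩
    · rw [mul_one, le_div_iff₀ hlog]
      have h1 : Real.log (1 / σ) ≤ Real.log 4 :=
        Real.log_le_log (by positivity) (by rw [div_le_iff₀ hσ]; linarith)
      exact (mul_le_mul_of_nonneg_left h1 hC'.le).trans (le_max_right _ _)
    · filter_upwards [ae_notMem_of_supMinDensity_lt_one hμ hc hE₁ hE₂ hσ.le hσ1 hS] with x hx hxE
      simp [hx hxE]
    · exact Eventually.of_forall fun x hx => by simp [hx]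

end SeparatingFunction

/-! ### Calculus of the `BMO` seminorm and of null-preserving maps -/

section FiniteNorm

open Filter Set Topology

variable {X : Type u} [MetricSpace X] [MeasurableSpace X] {c : ℝ} {μ : Measure X}

/-- The convention that the mean of a non-integrable function is `0` does no harm: a function of
finite `BMO` seminorm is integrable on every ball. -/
lemma MemBMO.integrableOn_ball [BorelSpace X] (hμ : IsDoublingMeasure c μ) {f : X → ℝ}
    (hf : MemBMO μ f) (x : X) {r : ℝ} (hr : 0 < r) : IntegrableOn f (ball x r) μ := by
  have := hμ.secondCountableTopology
  have : IsFiniteMeasure (μ.restrict (ball x r)) := ⟨by simpa using hμ.ball_lt_top x r hr⟩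
  have h1 : IntegrableOn (fun y => f y - ⨍ z in ball x r, f z ∂μ) (ball x r) μ :=
    ⟨(hf.1.aestronglyMeasurable.sub aestronglyMeasurable_const).restrict,
      (lintegral_sub_average_le_bmoNorm hμ f x hr).trans_lt
        (ENNReal.mul_lt_top hf.2 (hμ.ball_lt_top x r hr))⟩
  simpa [Pi.add_def] using h1.add (integrable_const (⨍ z in ball x r, f z ∂μ))

lemma bmoNorm_congr_ae {f g : X → ℝ} (h : f =ᵐ[μ] g) : bmoNorm μ f = bmoNorm μ g := by
  unfold bmoNorm
  refine iSup_congr fun x => iSup_congr fun r => iSup_congr fun _ => ?_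
  have h1 : f =ᵐ[μ.restrict (ball x r)] g := ae_restrict_of_ae h
  congr 1
  rw [average_congr h1]
  refine lintegral_congr_ae ?_
  filter_upwards [h1] with y hy
  rw [hy]

lemma bmoNorm_add_le [BorelSpace X] (hμ : IsDoublingMeasure c μ) {f g : X → ℝ}
    (hf : MemBMO μ f) (hg : MemBMO μ g) :
    bmoNorm μ (fun x => f x + g x) ≤ bmoNorm μ f + bmoNorm μ g := by
  have := hμ.secondCountableTopology
  refine bmoNorm_le_iff.2 fun x r hr => ?_
  rw [ENNReal.div_le_iff (hμ.ball_ne_zero x hr) (hμ.ball_ne_top x hr), add_mul]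
  have h1 : ⨍ z in ball x r, (f z + g z) ∂μ =
      (⨍ z in ball x r, f z ∂μ) + ⨍ z in ball x r, g z ∂μ := by
    rw [setAverage_eq, setAverage_eq, setAverage_eq,
      integral_add (hf.integrableOn_ball hμ x hr) (hg.integrableOn_ball hμ x hr), smul_add]
  rw [h1]
  calc _ ≤ ∫⁻ y in ball x r, (‖f y - ⨍ z in ball x r, f z ∂μ‖ₑ +
        ‖g y - ⨍ z in ball x r, g z ∂μ‖ₑ) ∂μ := by
        refine lintegral_mono fun y => ?_
        rw [add_sub_add_comm]
        exact enorm_add_le _ _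
    _ = _ := lintegral_add_left'
        (hf.1.aestronglyMeasurable.restrict.sub aestronglyMeasurable_const).enorm _
    _ ≤ _ := add_le_add (lintegral_sub_average_le_bmoNorm hμ f x hr)
        (lintegral_sub_average_le_bmoNorm hμ g x hr)

lemma MemBMO.add [BorelSpace X] (hμ : IsDoublingMeasure c μ) {f g : X → ℝ}
    (hf : MemBMO μ f) (hg : MemBMO μ g) : MemBMO μ (fun x => f x + g x) :=
  ⟨hf.1.add hg.1, (bmoNorm_add_le hμ hf hg).trans_lt (ENNReal.add_lt_top.2 ⟨hf.2, hg.2⟩)⟩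

lemma bmoNorm_sub_le [BorelSpace X] (hμ : IsDoublingMeasure c μ) {f g : X → ℝ}
    (hf : MemBMO μ f) (hg : MemBMO μ g) :
    bmoNorm μ (fun x => f x - g x) ≤ bmoNorm μ f + bmoNorm μ g := by
  have h := bmoNorm_add_le hμ hf (hg.const_mul (-1))
  rw [bmoNorm_const_mul, enorm_neg, enorm_one, one_mul] at h
  simpa [sub_eq_add_neg] using h

lemma bmoNorm_sub_const [BorelSpace X] (hμ : IsDoublingMeasure c μ) {f : X → ℝ}
    (hf : MemBMO μ f) (a : ℝ) : bmoNorm μ (fun x => f x - a) = bmoNorm μ f := by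
  unfold bmoNorm
  refine iSup_congr fun x => iSup_congr fun r => iSup_congr fun hr => ?_
  have : IsFiniteMeasure (μ.restrict (ball x r)) := ⟨by simpa using hμ.ball_lt_top x r hr⟩
  have h1 : ⨍ z in ball x r, (f z - a) ∂μ = (⨍ z in ball x r, f z ∂μ) - a := by
    rw [setAverage_eq, setAverage_eq, integral_sub (hf.integrableOn_ball hμ x hr)
      (integrable_const a)]
    simp [(real_ball_pos hμ x hr).ne', mul_sub]
  simp only [h1, sub_sub_sub_cancel_right]

lemma MemBMO.sub_const [BorelSpace X] (hμ : IsDoublingMeasure c μ) {f : X → ℝ}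
    (hf : MemBMO μ f) (a : ℝ) : MemBMO μ (fun x => f x - a) := by
  have := hμ.isLocallyFiniteMeasure
  exact ⟨hf.1.sub (locallyIntegrable_const a), by rw [bmoNorm_sub_const hμ hf]; exact hf.2⟩

/-- A function of mean zero on a ball is integrable on a larger ball, with a bound depending only on
its `BMO` norm. -/
lemma lintegral_enorm_le_of_average_eq_zero [BorelSpace X] (hμ : IsDoublingMeasure c μ)
    {f : X → ℝ} (hf : MemBMO μ f) (hf1 : bmoNorm μ f ≤ 1) (x : X) {r R : ℝ} (hr : 0 < r)
    (hrR : r ≤ R) (h0 : ⨍ z in ball x r, f z ∂μ = 0) :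
    ∫⁻ y in ball x R, ‖f y‖ₑ ∂μ ≤
      μ (ball x R) + μ (ball x R) / μ (ball x r) * μ (ball x R) := by
  have hR := hr.trans_le hrR
  have : IsFiniteMeasure (μ.restrict (ball x r)) := ⟨by simpa using hμ.ball_lt_top x r hr⟩
  set a := ⨍ z in ball x R, f z ∂μ
  have h1 : ∫⁻ y in ball x R, ‖f y - a‖ₑ ∂μ ≤ μ (ball x R) :=
    (lintegral_sub_average_le_bmoNorm hμ f x hR).trans
      ((mul_le_mul_left hf1 _).trans_eq (one_mul _))
  have h2 : ⨍ z in ball x r, (f z - a) ∂μ = -a := by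
    rw [setAverage_eq, integral_sub (hf.integrableOn_ball hμ x hr) (integrable_const a), smul_sub,
      ← setAverage_eq, h0]
    simp [(real_ball_pos hμ x hr).ne']
  have h3 : ‖a‖ₑ ≤ μ (ball x R) / μ (ball x r) := by
    have h4 := enorm_average_le (μ.restrict (ball x r)) (fun z => f z - a)
    rw [h2, enorm_neg, Measure.restrict_apply_univ] at h4
    exact h4.trans (ENNReal.div_le_div_right
      ((lintegral_mono_set (ball_subset_ball hrR)).trans h1) _)
  calc ∫⁻ y in ball x R, ‖f y‖ₑ ∂μ ≤ ∫⁻ y in ball x R, (‖f y - a‖ₑ + ‖a‖ₑ) ∂μ := by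
        refine lintegral_mono fun y => ?_
        simpa using enorm_add_le (f y - a) a
    _ = ∫⁻ y in ball x R, ‖f y - a‖ₑ ∂μ + ‖a‖ₑ * μ (ball x R) := by
        rw [lintegral_add_right _ measurable_const]; simp
    _ ≤ _ := add_le_add h1 (mul_le_mul_left h3 _)

/-- Separation of level sets passes to limits almost everywhere, by Fatou's lemma for sets. -/
lemma LevelSetsSeparated.of_ae_tendsto (hμ : IsDoublingMeasure c μ) {g : ℕ → X → ℝ} {f : X → ℝ}
    {s γ : ℝ} (hg : ∀ n, LevelSetsSeparated μ (g n) s γ)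
    (hlim : ∀ᵐ x ∂μ, Tendsto (fun n => g n x) atTop (𝓝 (f x))) :
    LevelSetsSeparated μ f s γ := by
  have key : ∀ (B P : Set X) (Q : ℕ → Set X) (b : ℝ≥0∞), (∃ᶠ n in atTop, μ (Q n ∩ B) ≤ b) →
      (∀ᵐ x ∂μ, x ∈ P → ∀ᶠ n in atTop, x ∈ Q n) → μ (P ∩ B) ≤ b := by
    intro B P Q b hQ hP
    have hmono : Monotone fun n : ℕ => ⋂ m ≥ n, Q m ∩ B := fun n n' hn =>
      biInter_subset_biInter_left fun m hm => le_trans hn hm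
    calc μ (P ∩ B) ≤ μ (⋃ n : ℕ, ⋂ m ≥ n, Q m ∩ B) := by
          refine measure_mono_ae ?_
          filter_upwards [hP] with x hx hxP
          obtain ⟨n, hn⟩ := eventually_atTop.1 (hx hxP.1)
          exact mem_iUnion.2 ⟨n, mem_iInter₂.2 fun m hm => ⟨hn m hm, hxP.2⟩⟩
      _ = ⨆ n : ℕ, μ (⋂ m ≥ n, Q m ∩ B) := hmono.measure_iUnion
      _ ≤ b := iSup_le fun n => by
          obtain ⟨m, hm, hle⟩ := frequently_atTop.1 hQ n
          exact (measure_mono (biInter_subset_of_mem hm)).trans hle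
  intro t
  refine (supMinDensity_le_iff hμ).2 fun x r hr => ?_
  have h1 : ∃ᶠ n in atTop,
      μ ({y | g n y < t} ∩ ball x r) ≤ ENNReal.ofReal γ * μ (ball x r) ∨
        μ ({y | t + s < g n y} ∩ ball x r) ≤ ENNReal.ofReal γ * μ (ball x r) :=
    (Eventually.of_forall fun n => (supMinDensity_le_iff hμ).1 (hg n t) x r hr).frequently
  rcases frequently_or_distrib.1 h1 with h | h
  · left
    refine key _ _ _ _ h ?_
    filter_upwards [hlim] with y hy hyt
    exact hy.eventually (gt_mem_nhds hyt)
  · right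
    refine key _ _ _ _ h ?_
    filter_upwards [hlim] with y hy hyt
    exact hy.eventually (lt_mem_nhds hyt)

lemma aemeasurable_comp_of_preimage_null {α : Type*} [MeasurableSpace α] {μ : Measure α} {F : α → α}
    (hF : NullMeasurable F μ) (hnull : ∀ E : Set α, μ E = 0 → μ (F ⁻¹' E) = 0) {f : α → ℝ}
    (hf : AEMeasurable f μ) :
    AEMeasurable (f ∘ F) μ := by
  have h1 : NullMeasurable (hf.mk f ∘ F) μ := fun s hs => hF (hf.measurable_mk hs)
  refine h1.aemeasurable.congr ?_
  have h2 := hnull _ hf.ae_eq_mk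
  exact (show ∀ᵐ x ∂μ, f (F x) = hf.mk f (F x) from h2).mono fun x hx => hx.symm

lemma ae_comp_of_preimage_null {α : Type*} [MeasurableSpace α] {μ : Measure α} {F : α → α}
    (hnull : ∀ E : Set α, μ E = 0 → μ (F ⁻¹' E) = 0) {P : α → Prop} (hP : ∀ᵐ x ∂μ, P x) :
    ∀ᵐ x ∂μ, P (F x) := hnull _ hP

/-- The seminorm of `f` enters through upper bounds `N > 0`, so that `‖f‖_* = 0` needs no separate
treatment. -/
lemma compOpNorm_le {F : X → X} {M : ℝ} (h : ∀ (f : X → ℝ) (N : ℝ), MemBMO μ f → 0 < N →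
    bmoNorm μ f ≤ ENNReal.ofReal N → bmoNorm μ (f ∘ F) ≤ ENNReal.ofReal (M * N)) (hM : 0 ≤ M) :
    compOpNorm μ F ≤ ENNReal.ofReal M := by
  refine sInf_le fun f hf => ?_
  have hb : ENNReal.ofReal (bmoNorm μ f).toReal = bmoNorm μ f := ENNReal.ofReal_toReal hf.2.ne
  have hT : Tendsto (fun ε : ℝ => ENNReal.ofReal (M * ((bmoNorm μ f).toReal + ε))) (𝓝[>] 0)
      (𝓝 (ENNReal.ofReal (M * ((bmoNorm μ f).toReal + 0)))) :=
    (ENNReal.continuous_ofReal.comp (by fun_prop : Continuous fun ε : ℝ =>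
      M * ((bmoNorm μ f).toReal + ε))).continuousAt.tendsto.mono_left nhdsWithin_le_nhds
  rw [add_zero, ENNReal.ofReal_mul hM, hb] at hT
  refine ge_of_tendsto hT ?_
  filter_upwards [self_mem_nhdsWithin] with ε hε
  have hε : 0 < ε := hε
  refine h f _ hf (by positivity) ?_
  conv_lhs => rw [← hb]
  exact ENNReal.ofReal_le_ofReal (by linarith)

lemma bmoNorm_comp_le {F : X → X} (hfin : compOpNorm μ F < ∞) {f : X → ℝ} (hf : MemBMO μ f) :
    bmoNorm μ (f ∘ F) ≤ compOpNorm μ F * bmoNorm μ f := by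
  have hne : {M : ℝ≥0∞ | ∀ f : X → ℝ, MemBMO μ f →
      bmoNorm μ (f ∘ F) ≤ M * bmoNorm μ f}.Nonempty := by
    by_contra h
    rw [not_nonempty_iff_eq_empty] at h
    rw [compOpNorm, h, sInf_empty] at hfin
    exact lt_irrefl _ hfin
  obtain ⟨w, -, hw, hwS⟩ := exists_seq_tendsto_sInf hne (OrderBot.bddBelow _)
  exact ge_of_tendsto' (ENNReal.Tendsto.mul_const hw (Or.inr hf.2.ne)) fun n => hwS n f hf

end FiniteNorm

/-! ### Boundedness of composition with a `BMO`-map -/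

section FiniteNorm

open Filter Set Topology

variable {X : Type u} [MetricSpace X] [MeasurableSpace X] [BorelSpace X] {c : ℝ} {μ : Measure X}

/-- The level sets of functions of bounded `BMO` norm are separated at a common scale. -/
lemma exists_levelSetsSeparated_of_bmoNorm_le (hμ : IsDoublingMeasure c μ) (hc : 1 < c) {γ : ℝ}
    (hγ : 0 < γ) {N : ℝ} (hN : 0 < N) : ∃ M : ℕ, ∀ f : X → ℝ, AEMeasurable f μ →
      bmoNorm μ f ≤ ENNReal.ofReal N → LevelSetsSeparated μ f (M + 1) γ := by
  obtain ⟨C, a, hC, ha, h⟩ := exists_supMinDensity_level_le.{u} hc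
  have h1 : Tendsto (fun M : ℕ => C * Real.exp (-(a * ((M : ℝ) + 1) / N))) atTop (𝓝 (C * 0)) := by
    refine (Real.tendsto_exp_neg_atTop_nhds_zero.comp ?_).const_mul C
    refine Tendsto.atTop_div_const hN (Tendsto.const_mul_atTop ha ?_)
    exact tendsto_atTop_add_const_right _ _ tendsto_natCast_atTop_atTop
  rw [mul_zero] at h1
  obtain ⟨M, hM⟩ := (h1.eventually (gt_mem_nhds hγ)).exists
  exact ⟨M, fun f hf hfN => levelSetsSeparated_of_supMinDensity_le fun t =>
    (h X μ hμ f N hf hN hfN t _ (by positivity)).trans (ENNReal.ofReal_le_ofReal hM.le)⟩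

/-- The sum of those terms of the series `∑ 2⁻ⁿ hₙ` that are selected by `b`. -/
noncomputable def selectedSum {α : Type*} (h : ℕ → α → ℝ) (b : ℕ → Bool) (x : α) : ℝ :=
  ∑' n, if b n then (1 / 2) ^ n * h n x else 0

lemma ae_summable_of_average_eq_zero (hμ : IsDoublingMeasure c μ) {h : ℕ → X → ℝ} (x₀ : X)
    (hh : ∀ n, MemBMO μ (h n)) (h1 : ∀ n, bmoNorm μ (h n) ≤ 1)
    (h0 : ∀ n, ⨍ z in ball x₀ 1, h n z ∂μ = 0) :
    ∀ᵐ x ∂μ, Summable fun n => ‖(1 / 2) ^ n * h n x‖ := by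
  have := hμ.secondCountableTopology
  have hball : ∀ k : ℕ, ∀ᵐ x ∂μ.restrict (ball x₀ (k + 1)),
      Summable fun n => ‖(1 / 2) ^ n * h n x‖ := by
    intro k
    have hk : (0 : ℝ) < k + 1 := by positivity
    set D := μ (ball x₀ (k + 1)) + μ (ball x₀ (k + 1)) / μ (ball x₀ 1) * μ (ball x₀ (k + 1))
    have hD : D ≠ ∞ := by
      have h2 := hμ.ball_ne_top x₀ hk
      exact ENNReal.add_ne_top.2 ⟨h2, ENNReal.mul_ne_top
        (ENNReal.div_ne_top h2 (hμ.ball_ne_zero x₀ one_pos)) h2⟩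
    have hm : ∀ n, AEMeasurable (fun x => ‖(1 / 2) ^ n * h n x‖ₑ) (μ.restrict (ball x₀ (k + 1))) :=
      fun n => ((hh n).1.aestronglyMeasurable.aemeasurable.const_mul _).enorm.restrict
    have hsum : ∫⁻ x in ball x₀ (k + 1), ∑' n, ‖(1 / 2) ^ n * h n x‖ₑ ∂μ ≠ ∞ := by
      rw [lintegral_tsum hm]
      refine ne_top_of_le_ne_top (b := ∑' n : ℕ, ENNReal.ofReal ((1 / 2) ^ n) * D) ?_ ?_
      · rw [ENNReal.tsum_mul_right, ← ENNReal.ofReal_tsum_of_nonneg (fun n => by positivity)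
          summable_geometric_two]
        exact ENNReal.mul_ne_top ENNReal.ofReal_ne_top hD
      · refine ENNReal.tsum_le_tsum fun n => ?_
        simp only [enorm_mul]
        rw [lintegral_const_mul' _ _ (by simp), Real.enorm_eq_ofReal (by positivity)]
        exact mul_le_mul_right (lintegral_enorm_le_of_average_eq_zero hμ (hh n) (h1 n) x₀ one_pos
          (by linarith [(Nat.cast_nonneg k : (0 : ℝ) ≤ k)]) (h0 n)) _
    filter_upwards [ae_lt_top' (AEMeasurable.tsum hm) hsum] with x hx
    have h2 := ENNReal.summable_toReal hx.ne
    simpa only [toReal_enorm] using h2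
  rw [← Measure.restrict_univ (μ := μ), show (univ : Set X) = ⋃ k : ℕ, ball x₀ (k + 1) from
    (eq_univ_of_forall fun y => by
      obtain ⟨n, hn⟩ := exists_nat_gt (dist y x₀)
      exact mem_iUnion.2 ⟨n, mem_ball.2 (by linarith)⟩).symm]
  exact ae_restrict_iUnion_iff _ _ |>.2 hball

lemma memBMO_selectedSum (hμ : IsDoublingMeasure c μ) (hc : 1 < c) {h : ℕ → X → ℝ}
    (hh : ∀ n, MemBMO μ (h n)) (h1 : ∀ n, bmoNorm μ (h n) ≤ 1)
    (hsum : ∀ᵐ x ∂μ, Summable fun n => ‖(1 / 2) ^ n * h n x‖) (b : ℕ → Bool) :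
    MemBMO μ (selectedSum h b) := by
  have := hμ.secondCountableTopology
  have hterm : ∀ n, MemBMO μ (fun x => if b n then (1 / 2) ^ n * h n x else 0) ∧
      bmoNorm μ (fun x => if b n then (1 / 2) ^ n * h n x else 0) ≤
        ENNReal.ofReal ((1 / 2) ^ n) := by
    intro n
    have key : ∀ a : ℝ, 0 ≤ a → a ≤ (1 / 2) ^ n → MemBMO μ (fun x => a * h n x) ∧
        bmoNorm μ (fun x => a * h n x) ≤ ENNReal.ofReal ((1 / 2) ^ n) := by
      intro a ha ha'
      refine ⟨(hh n).const_mul a, ?_⟩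
      rw [bmoNorm_const_mul, Real.enorm_eq_ofReal ha]
      exact (mul_le_mul' (ENNReal.ofReal_le_ofReal ha') (h1 n)).trans_eq (mul_one _)
    cases hb : b n
    · simpa using key 0 le_rfl (by positivity)
    · simpa using key ((1 / 2) ^ n) (by positivity) le_rfl
  have hpart : ∀ m, MemBMO μ (fun x => ∑ n ∈ Finset.range m,
        if b n then (1 / 2) ^ n * h n x else 0) ∧
      bmoNorm μ (fun x => ∑ n ∈ Finset.range m, if b n then (1 / 2) ^ n * h n x else 0) ≤
        ENNReal.ofReal (2 - 2 * (1 / 2) ^ m) := by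
    intro m
    induction m with
    | zero =>
      have h2 := (hh 0).const_mul 0
      have h3 := bmoNorm_const_mul (μ := μ) (h 0) 0
      simp only [zero_mul, enorm_zero] at h2 h3
      simp [h2, h3]
    | succ m ih =>
      simp only [Finset.sum_range_succ]
      refine ⟨ih.1.add hμ (hterm m).1, ((bmoNorm_add_le hμ ih.1 (hterm m).1).trans
        (add_le_add ih.2 (hterm m).2)).trans_eq ?_⟩
      have h2 : (1 / 2 : ℝ) ^ m ≤ 1 := pow_le_one₀ (by norm_num) (by norm_num)
      rw [← ENNReal.ofReal_add (by linarith) (by positivity)]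
      ring_nf
  have hlim : ∀ᵐ x ∂μ, Tendsto (fun m => ∑ n ∈ Finset.range m,
      if b n then (1 / 2) ^ n * h n x else 0) atTop (𝓝 (selectedSum h b x)) := by
    filter_upwards [hsum] with x hx
    refine (Summable.of_norm_bounded hx fun n => ?_).hasSum.tendsto_sum_nat
    split_ifs
    · exact le_rfl
    · simp
  have hm : ∀ m, AEMeasurable (fun x => ∑ n ∈ Finset.range m,
      if b n then (1 / 2) ^ n * h n x else 0) μ := fun m =>
    (hpart m).1.1.aestronglyMeasurable.aemeasurable
  have hγ : (0 : ℝ) < 1 / (8 * c ^ 3) := by positivity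
  obtain ⟨M, hM⟩ := exists_levelSetsSeparated_of_bmoNorm_le hμ hc hγ two_pos
  obtain ⟨C, -, hC⟩ := exists_bmoNorm_le_of_levelSetsSeparated.{u} hc hγ.le
    (one_div_lt_one_div_of_lt (by positivity) (by linarith [pow_pos (one_pos.trans hc) 3]))
  refine (hC X μ hμ _ _ (aemeasurable_of_tendsto_metrizable_ae' hm hlim) (by positivity)
    (.of_ae_tendsto hμ (fun m => hM _ (hm m) ((hpart m).2.trans (ENNReal.ofReal_le_ofReal ?_)))
      hlim)).1
  have : (0 : ℝ) ≤ (1 / 2) ^ m := by positivity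
  linarith

/-- Composition with a `BMO`-map is bounded, by the Baire category theorem: on the compact space of
selections, the function `selectedSum h b ∘ F`, which always has finite norm, has bounded norm on
a nonempty open set, so that all but finitely many terms of the series have bounded norm. -/
lemma IsBMOMap.exists_bmoNorm_comp_le (hμ : IsDoublingMeasure c μ) (hc : 1 < c) {F : X → X}
    (hF : IsBMOMap μ F) : ∃ M : ℝ, 0 ≤ M ∧ ∀ f : X → ℝ, MemBMO μ f → bmoNorm μ f ≤ 1 →
      bmoNorm μ (f ∘ F) ≤ ENNReal.ofReal M := by
  rcases isEmpty_or_nonempty X with hX | ⟨⟨x₀⟩⟩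
  · exact ⟨0, le_rfl, fun f _ _ => by simp [bmoNorm]⟩
  by_contra! hcon
  choose g hg hg1 hgF using fun n : ℕ => hcon (4 ^ n) (by positivity)
  have := hμ.secondCountableTopology
  set h : ℕ → X → ℝ := fun n x => g n x - ⨍ z in ball x₀ 1, g n z ∂μ
  have hh : ∀ n, MemBMO μ (h n) := fun n => (hg n).sub_const hμ _
  have h1 : ∀ n, bmoNorm μ (h n) ≤ 1 := fun n => (bmoNorm_sub_const hμ (hg n) _).trans_le (hg1 n)
  have h0 : ∀ n, ⨍ z in ball x₀ 1, h n z ∂μ = 0 := by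
    intro n
    have : IsFiniteMeasure (μ.restrict (ball x₀ 1)) := ⟨by simpa using hμ.ball_lt_top x₀ 1 one_pos⟩
    rw [setAverage_eq, integral_sub ((hg n).integrableOn_ball hμ x₀ one_pos) (integrable_const _),
      smul_sub, ← setAverage_eq]
    simp [(real_ball_pos hμ x₀ one_pos).ne']
  have hhF : ∀ n, ENNReal.ofReal (4 ^ n) < bmoNorm μ (h n ∘ F) := fun n =>
    (hgF n).trans_eq (bmoNorm_sub_const hμ (hF.comp_mem _ (hg n)) _).symm
  have hsum := ae_summable_of_average_eq_zero hμ x₀ hh h1 h0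
  have hsumF : ∀ᵐ x ∂μ, Summable fun n => ‖(1 / 2) ^ n * h n (F x)‖ :=
    ae_comp_of_preimage_null hF.preimage_null hsum
  have hS : ∀ b, MemBMO μ (selectedSum h b ∘ F) := fun b =>
    hF.comp_mem _ (memBMO_selectedSum hμ hc hh h1 hsum b)
  set γ := 1 / (8 * c ^ 3)
  have hγ : 0 < γ := by positivity
  obtain ⟨C, hC0, hC⟩ := exists_bmoNorm_le_of_levelSetsSeparated.{u} hc hγ.le
    (one_div_lt_one_div_of_lt (by positivity) (by linarith [pow_pos (one_pos.trans hc) 3]))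
  let A : ℕ → Set (ℕ → Bool) := fun M =>
    {b | LevelSetsSeparated μ (selectedSum h b ∘ F) (M + 1) γ}
  have hAclosed : ∀ M, IsClosed (A M) := by
    intro M
    refine IsSeqClosed.isClosed fun b b₀ hb hlim => ?_
    refine LevelSetsSeparated.of_ae_tendsto hμ hb ?_
    filter_upwards [hsumF] with x hx
    refine tendsto_tsum_of_dominated_convergence hx (fun n => ?_)
      (Eventually.of_forall fun k n => ?_)
    · refine tendsto_const_nhds.congr' ?_
      have h2 := (tendsto_pi_nhds.1 hlim n).eventually
        (mem_nhds_discrete.2 (mem_singleton (b₀ n)))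
      filter_upwards [h2] with k hk
      rw [mem_singleton_iff.1 hk]
    · split_ifs
      · exact le_rfl
      · simp
  have hAcover : ⋃ M, A M = univ := by
    refine eq_univ_of_forall fun b => mem_iUnion.2 ?_
    obtain ⟨M, hM⟩ := exists_levelSetsSeparated_of_bmoNorm_le hμ hc hγ
      (N := (bmoNorm μ (selectedSum h b ∘ F)).toReal + 1) (by positivity)
    refine ⟨M, hM _ (hS b).1.aestronglyMeasurable.aemeasurable ?_⟩
    conv_lhs => rw [← ENNReal.ofReal_toReal (hS b).2.ne]
    exact ENNReal.ofReal_le_ofReal (by linarith)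
  obtain ⟨M, b, hb⟩ := nonempty_interior_of_iUnion_of_closed hAclosed hAcover
  have hflip : ∀ v : Bool, ∀ᶠ n in atTop, Function.update b n v ∈ A M := by
    intro v
    have h2 : Tendsto (fun n => Function.update b n v) atTop (𝓝 b) := by
      refine tendsto_pi_nhds.2 fun k => tendsto_const_nhds.congr' ?_
      filter_upwards [eventually_gt_atTop k] with n hn
      rw [Function.update_of_ne hn.ne]
    exact (h2.eventually (isOpen_interior.mem_nhds hb)).mono fun n hn => interior_subset hn
  have hbig : ∀ᶠ n : ℕ in atTop, 2 * (C * (M + 1)) < 2 ^ n :=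
    (tendsto_pow_atTop_atTop_of_one_lt one_lt_two).eventually_gt_atTop _
  obtain ⟨n, hn1, hn2, hn3⟩ := ((hflip true).and ((hflip false).and hbig)).exists
  have hnorm : ∀ v, Function.update b n v ∈ A M →
      bmoNorm μ (selectedSum h (Function.update b n v) ∘ F) ≤ ENNReal.ofReal (C * (M + 1)) :=
    fun v hv => (hC X μ hμ _ _ (hS _).1.aestronglyMeasurable.aemeasurable (by positivity) hv).2
  -- two selections that differ in the `n`-th term only
  have hdiff : (fun x => (1 / 2) ^ n * (h n ∘ F) x) =ᵐ[μ] fun x =>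
      (selectedSum h (Function.update b n true) ∘ F) x -
        (selectedSum h (Function.update b n false) ∘ F) x := by
    filter_upwards [hsumF] with x hx
    have hs : ∀ b : ℕ → Bool, Summable fun k => if b k then (1 / 2) ^ k * h k (F x) else 0 :=
      fun b => Summable.of_norm_bounded hx fun k => by
        split_ifs
        · exact le_rfl
        · simp
    simp only [Function.comp_apply, selectedSum]
    rw [← (hs _).tsum_sub (hs _), tsum_eq_single n]
    · simp
    · intro k hk
      simp [Function.update_of_ne hk]
  have h3 : bmoNorm μ (fun x => (1 / 2) ^ n * (h n ∘ F) x) ≤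
      ENNReal.ofReal (2 * (C * (M + 1))) := by
    rw [bmoNorm_congr_ae hdiff, two_mul, ENNReal.ofReal_add (by positivity) (by positivity)]
    exact (bmoNorm_sub_le hμ (hS _) (hS _)).trans (add_le_add (hnorm _ hn1) (hnorm _ hn2))
  rw [bmoNorm_const_mul, Real.enorm_eq_ofReal (by positivity)] at h3
  have h4 : ENNReal.ofReal ((1 / 2) ^ n * 4 ^ n) ≤ ENNReal.ofReal (2 * (C * (M + 1))) := by
    rw [ENNReal.ofReal_mul (by positivity)]
    exact (mul_le_mul_right (hhF n).le _).trans h3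
  rw [ENNReal.ofReal_le_ofReal_iff (by positivity), ← mul_pow] at h4
  norm_num at h4
  linarith

lemma IsBMOMap.compOpNorm_lt_top (hμ : IsDoublingMeasure c μ) (hc : 1 < c) {F : X → X}
    (hF : IsBMOMap μ F) : compOpNorm μ F < ∞ := by
  obtain ⟨M, hM, h⟩ := hF.exists_bmoNorm_comp_le hμ hc
  refine (compOpNorm_le (M := M) (fun f N hf hN hfN => ?_) hM).trans_lt ENNReal.ofReal_lt_top
  have h1 := h (fun x => N⁻¹ * f x) (hf.const_mul _) (by
    rw [bmoNorm_const_mul, Real.enorm_eq_ofReal (by positivity)]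
    refine (mul_le_mul_right hfN _).trans_eq ?_
    rw [← ENNReal.ofReal_mul (by positivity), inv_mul_cancel₀ hN.ne', ENNReal.ofReal_one])
  have h2 := bmoNorm_const_mul (μ := μ) ((fun x => N⁻¹ * f x) ∘ F) N
  have h3 : (fun x => N * ((fun x => N⁻¹ * f x) ∘ F) x) = f ∘ F := by
    ext x
    simp [hN.ne']
  rw [h3, Real.enorm_eq_ofReal hN.le] at h2
  rw [h2, mul_comm M, ENNReal.ofReal_mul hN.le]
  exact mul_le_mul_right h1 _

end FiniteNorm

/-! ### Composition operators -/

section Composition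

open Filter Set Topology

lemma compOpNorm_of_isEmpty {X : Type u} [MetricSpace X] [MeasurableSpace X] [IsEmpty X]
    (μ : Measure X) (F : X → X) : compOpNorm μ F = 0 :=
  nonpos_iff_eq_zero.1 (sInf_le fun f _ => by simp [bmoNorm])

variable {X : Type u} [MetricSpace X] [MeasurableSpace X] {c : ℝ} {μ : Measure X}

lemma one_le_of_supMinDensity_univ_le [Nonempty X] (hμ : IsDoublingMeasure c μ) {a : ℝ≥0∞}
    (h : supMinDensity μ univ univ ≤ a) : 1 ≤ a := by
  obtain ⟨x⟩ := ‹Nonempty X›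
  have h1 : μ (ball x 1) ≤ a * μ (ball x 1) := by
    simpa using (supMinDensity_le_iff hμ).1 h x 1 one_pos
  by_contra! hlt
  have h2 := (ENNReal.mul_lt_mul_iff_left (hμ.ball_ne_zero x one_pos)
    (hμ.ball_ne_top x one_pos)).2 hlt
  rw [one_mul] at h2
  exact absurd h1 (not_le.2 h2)

lemma supMinDensity_eq_zero (hμ : IsDoublingMeasure c μ) {E₁ E₂ : Set X} (h : μ E₁ = 0) :
    supMinDensity μ E₁ E₂ = 0 :=
  nonpos_iff_eq_zero.1 ((supMinDensity_le_iff hμ).2 fun x r _ =>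
    Or.inl (by rw [measure_mono_null inter_subset_left h]; exact zero_le))

lemma supMinDensity_le_half (hμ : IsDoublingMeasure c μ) {E₁ E₂ : Set X}
    (hE : NullMeasurableSet E₁ μ) (hd : Disjoint E₁ E₂) :
    supMinDensity μ E₁ E₂ ≤ ENNReal.ofReal (1 / 2) := by
  refine (supMinDensity_le_iff hμ).2 fun x r hr => ?_
  by_contra! hlt
  have h1 : μ (E₁ ∩ ball x r) + μ (E₂ ∩ ball x r) ≤ μ (ball x r) := by
    rw [← measure_inter_add_sdiff₀ (ball x r) hE, inter_comm E₁]
    gcongr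
    exact fun y hy => ⟨hy.2, fun h => disjoint_left.1 hd h hy.1⟩
  have h2 := (ENNReal.add_lt_add hlt.1 hlt.2).trans_le h1
  rw [← add_mul, ← ENNReal.ofReal_add (by norm_num) (by norm_num)] at h2
  norm_num at h2

lemma supMinDensity_mono_ae {E₁ E₂ G₁ G₂ : Set X} (h1 : ∀ᵐ x ∂μ, x ∈ E₁ → x ∈ G₁)
    (h2 : ∀ᵐ x ∂μ, x ∈ E₂ → x ∈ G₂) : supMinDensity μ E₁ E₂ ≤ supMinDensity μ G₁ G₂ := by
  unfold supMinDensity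
  refine iSup_mono fun x => iSup_mono fun r => iSup_mono fun _ => min_le_min ?_ ?_
  · refine ENNReal.div_le_div_right (measure_mono_ae ?_) _
    filter_upwards [h1] with y hy hyE using ⟨hy hyE.1, hyE.2⟩
  · refine ENNReal.div_le_div_right (measure_mono_ae ?_) _
    filter_upwards [h2] with y hy hyE using ⟨hy hyE.1, hyE.2⟩

/-- A map is null-preserving if preimages of null sets have density bounded away from `1`. -/
lemma preimage_null_of_supMinDensity_le [BorelSpace X] (hμ : IsDoublingMeasure c μ) (hc : 1 < c)
    {F : X → X} (hF : NullMeasurable F μ) {σ : ℝ} (hσ0 : 0 ≤ σ) (hσ : σ < 1)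
    (h : ∀ E, MeasurableSet E → supMinDensity μ E univ = 0 →
      supMinDensity μ (F ⁻¹' E) univ ≤ ENNReal.ofReal σ) (E : Set X) (hE : μ E = 0) :
    μ (F ⁻¹' E) = 0 := by
  have hm := measurableSet_toMeasurable μ E
  have h1 := ae_notMem_of_supMinDensity_lt_one hμ hc (hF hm) nullMeasurableSet_univ hσ0 hσ
    (h _ hm (supMinDensity_eq_zero hμ (by rw [measure_toMeasurable, hE])))
  have h2 : ∀ᵐ x ∂μ, x ∉ F ⁻¹' toMeasurable μ E := by
    filter_upwards [h1] with x hx hxE using hx hxE (mem_univ x)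
  exact measure_mono_null (preimage_mono (subset_toMeasurable μ E))
    (measure_eq_zero_iff_ae_notMem.2 h2)

/-- If the preimages of the level sets of `f` at distance `T` have small joint density whenever
`f` has `BMO` norm at most `N`, then `F` is a `BMO`-map, with a norm bound proportional to
`T / N`. -/
lemma isBMOMap_of_supMinDensity_preimage_le [BorelSpace X] (hμ : IsDoublingMeasure c μ)
    {F : X → X} (hF : NullMeasurable F μ) (hnull : ∀ E : Set X, μ E = 0 → μ (F ⁻¹' E) = 0)
    {γ C M : ℝ} (hC : 0 < C) (hM : 0 < M)
    (hS : ∀ (f : X → ℝ) (s : ℝ), AEMeasurable f μ → 0 < s → LevelSetsSeparated μ f s γ →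
      MemBMO μ f ∧ bmoNorm μ f ≤ ENNReal.ofReal (C * s))
    (h : ∀ (f : X → ℝ) (N t : ℝ), AEMeasurable f μ → 0 < N → bmoNorm μ f ≤ ENNReal.ofReal N →
      supMinDensity μ (F ⁻¹' {x | f x ≤ t}) (F ⁻¹' {x | t + M * N ≤ f x}) ≤ ENNReal.ofReal γ) :
    IsBMOMap μ F ∧ compOpNorm μ F ≤ ENNReal.ofReal (C * M) := by
  have := hμ.secondCountableTopology
  have key : ∀ (f : X → ℝ) (N : ℝ), MemBMO μ f → 0 < N → bmoNorm μ f ≤ ENNReal.ofReal N →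
      MemBMO μ (f ∘ F) ∧ bmoNorm μ (f ∘ F) ≤ ENNReal.ofReal (C * M * N) := by
    intro f N hf hN hfN
    have hfm := hf.1.aestronglyMeasurable.aemeasurable
    rw [mul_assoc]
    exact hS _ _ (aemeasurable_comp_of_preimage_null hF hnull hfm) (by positivity)
      (levelSetsSeparated_of_supMinDensity_le fun t => h f N t hfm hN hfN)
  refine ⟨⟨hnull, fun f hf => (key f ((bmoNorm μ f).toReal + 1) hf (by positivity) ?_).1⟩,
    compOpNorm_le (fun f N hf hN hfN => (key f N hf hN hfN).2) (by positivity)⟩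
  conv_lhs => rw [← ENNReal.ofReal_toReal hf.2.ne]
  exact ENNReal.ofReal_le_ofReal (by linarith)

theorem exists_compOpNorm_le_of_powerEstimate (hc : 1 < c) : ∃ C : ℝ, 0 < C ∧
    ∀ (X : Type u) [MetricSpace X] [MeasurableSpace X] [BorelSpace X] (μ : Measure X),
      IsDoublingMeasure c μ → ∀ F : X → X, NullMeasurable F μ → ∀ K α : ℝ, 0 < K → 0 < α →
        PowerEstimate μ F K α → IsBMOMap μ F ∧ compOpNorm μ F ≤ ENNReal.ofReal (C * K / α) := by
  set γ := 1 / (8 * c ^ 3)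
  have hγ : 0 < γ := by positivity
  have hc3 : 1 < c ^ 3 := one_lt_pow₀ hc (by norm_num)
  have hγ1 : γ < 1 := by simp only [γ]; rw [div_lt_one (by positivity)]; linarith
  obtain ⟨C₁, a, hC₁, ha, hJN⟩ := exists_supMinDensity_level_le.{u} hc
  obtain ⟨C₂, hC₂, hS⟩ := exists_bmoNorm_le_of_levelSetsSeparated.{u} hc hγ.le
    (one_div_lt_one_div_of_lt (by positivity) (by linarith : 4 * c ^ 3 < 8 * c ^ 3))
  have hlogC : 0 ≤ Real.log C₁ := Real.log_nonneg hC₁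
  set B := 1 + (2 * Real.log C₁ + 1) / (γ * a)
  have hB : 0 < B := by positivity
  refine ⟨C₂ * B, by positivity, ?_⟩
  intro X _ _ _ μ hμ F hF K α hK hα hP
  have hnull : ∀ E : Set X, μ E = 0 → μ (F ⁻¹' E) = 0 :=
    preimage_null_of_supMinDensity_le hμ hc hF le_rfl one_pos fun E hE h0 => by
      have := hP E univ hE.nullMeasurableSet nullMeasurableSet_univ
      rwa [h0, ENNReal.zero_rpow_of_pos hα, mul_zero, ← ENNReal.ofReal_zero] at this
  rw [mul_assoc, mul_div_assoc]
  have hlevel : ∀ (f : X → ℝ) (σ t T : ℝ), AEMeasurable f μ → 0 < σ → K * σ ^ α ≤ γ →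
      supMinDensity μ {x | f x ≤ t} {x | t + T ≤ f x} ≤ ENNReal.ofReal σ →
        supMinDensity μ (F ⁻¹' {x | f x ≤ t}) (F ⁻¹' {x | t + T ≤ f x}) ≤ ENNReal.ofReal γ := by
    intro f σ t T hf hσ hKσ h
    refine (hP _ _ (hf.nullMeasurable measurableSet_Iic)
      (hf.nullMeasurable measurableSet_Ici)).trans
      ((mul_le_mul_right (ENNReal.rpow_le_rpow h hα.le) _).trans ?_)
    rw [ENNReal.ofReal_rpow_of_pos hσ, ← ENNReal.ofReal_mul hK.le]
    exact ENNReal.ofReal_le_ofReal hKσ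
  refine isBMOMap_of_supMinDensity_preimage_le hμ hF hnull hC₂ (M := B * K / α) (by positivity)
    (hS X μ hμ) fun f N t hf hN hfN => ?_
  have hT : 0 < B * K / α * N := by positivity
  rcases le_or_gt (K * (1 / 2) ^ α) γ with hKα | hKα
  · -- disjoint sets have joint density at most `1 / 2`, whatever their distance
    refine hlevel f (1 / 2) t _ hf (by norm_num) hKα (supMinDensity_le_half hμ
      (hf.nullMeasurable measurableSet_Iic) ?_)
    refine disjoint_left.2 fun x hx1 hx2 => ?_
    have hx1 : f x ≤ t := hx1
    have hx2 : t + B * K / α * N ≤ f x := hx2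
    linarith
  -- otherwise `K` is at least comparable to `α`, which absorbs the constants
  rcases isEmpty_or_nonempty X with hX | hX
  · exact (supMinDensity_le_iff hμ).2 fun x => hX.elim x
  have hK1 : 1 ≤ K := by
    have h1 := hP univ univ nullMeasurableSet_univ nullMeasurableSet_univ
    have h2 := one_le_of_supMinDensity_univ_le hμ (h1.trans (mul_le_mul_right
      (ENNReal.rpow_le_one (supMinDensity_le_one hμ _ _) hα.le) _))
    rwa [mul_one, ← ENNReal.ofReal_one, ENNReal.ofReal_le_ofReal_iff hK.le] at h2
  have hKγ : α ≤ 2 * K / γ := by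
    have h1 : α / 2 ≤ 2 ^ α := by
      rw [Real.rpow_def_of_pos two_pos]
      have h2 := Real.add_one_le_exp (Real.log 2 * α)
      have h3 := Real.log_two_gt_d9
      nlinarith
    rw [Real.div_rpow zero_le_one zero_le_two, Real.one_rpow, mul_one_div,
      lt_div_iff₀ (by positivity)] at hKα
    rw [le_div_iff₀ hγ]
    nlinarith
  set σ := (γ / K) ^ (1 / α)
  have hσ : 0 < σ := by positivity
  refine hlevel f σ t _ hf hσ ?_ ((hJN X μ hμ f N hf hN hfN t _ hT).trans
    (ENNReal.ofReal_le_ofReal ?_))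
  · rw [← Real.rpow_mul (by positivity), one_div_mul_cancel hα.ne', Real.rpow_one,
      mul_div_cancel₀ _ hK.ne']
  · have h1 : σ = Real.exp (-(Real.log (K / γ) / α)) := by
      simp only [σ]
      rw [Real.rpow_def_of_pos (by positivity), ← inv_div K γ, Real.log_inv]
      ring_nf
    have h2 : C₁ = Real.exp (Real.log C₁) := (Real.exp_log (by linarith)).symm
    rw [h1]
    conv_lhs => rw [h2]
    rw [← Real.exp_add]
    refine Real.exp_le_exp.2 ?_
    have h3 : Real.log (K / γ) ≤ K / γ := (Real.log_le_sub_one_of_pos (by positivity)).trans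
      (by linarith)
    have h4 : a * (B * K / α * N) / N = a * B * K / α := by field_simp
    have h5 : Real.log C₁ + K / γ / α ≤ a * B * K / α := by
      have h6 : a * B * K / α = a * K / α + (2 * Real.log C₁ + 1) * K / (γ * α) := by
        simp only [B]; field_simp
      have h7 : Real.log C₁ ≤ 2 * Real.log C₁ * K / (γ * α) := by
        rw [le_div_iff₀ (by positivity)]
        rw [le_div_iff₀ hγ] at hKγ
        nlinarith
      have h8 : 0 < a * K / α := by positivity
      have h9 : (2 * Real.log C₁ + 1) * K / (γ * α) =
          2 * Real.log C₁ * K / (γ * α) + K / γ / α := by field_simp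
      linarith
    have h6 : Real.log (K / γ) / α ≤ K / γ / α := by gcongr
    rw [h4]
    linarith

theorem exists_compOpNorm_le_of_thresholdEstimate (hc : 1 < c) {γ : ℝ} (hγ : 0 < γ)
    (hγc : γ < 1 / (4 * c ^ 3)) : ∃ C : ℝ, 0 < C ∧
      ∀ (X : Type u) [MetricSpace X] [MeasurableSpace X] [BorelSpace X] (μ : Measure X),
        IsDoublingMeasure c μ → ∀ F : X → X, NullMeasurable F μ → ∀ l : ℝ, 0 < l →
          ThresholdEstimate μ F γ l →
            IsBMOMap μ F ∧ compOpNorm μ F ≤ ENNReal.ofReal (C * (1 + Real.log (1 / l))) := by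
  have hc3 : 1 < c ^ 3 := one_lt_pow₀ hc (by norm_num)
  have hγ1 : γ < 1 := hγc.trans (by rw [div_lt_one (by positivity)]; linarith)
  obtain ⟨C₁, a, hC₁, ha, hJN⟩ := exists_supMinDensity_level_le.{u} hc
  obtain ⟨C₂, hC₂, hS⟩ := exists_bmoNorm_le_of_levelSetsSeparated.{u} hc hγ.le hγc
  have hlogC : 0 ≤ Real.log C₁ := Real.log_nonneg hC₁
  set B := (1 + Real.log C₁) / a
  have hB : 0 < B := by positivity
  refine ⟨C₂ * B, by positivity, ?_⟩
  intro X _ _ _ μ hμ F hF l hl hT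
  rcases isEmpty_or_nonempty X with hX | hX
  · refine ⟨⟨fun E _ => ?_, fun f hf => ?_⟩, ?_⟩
    · rw [eq_empty_of_isEmpty (F ⁻¹' E), measure_empty]
    · rwa [Subsingleton.elim (f ∘ F) f]
    · rw [compOpNorm_of_isEmpty]
      exact zero_le
  have hl1 : l ≤ 1 := by
    by_contra! h
    have h1 := hT univ univ nullMeasurableSet_univ nullMeasurableSet_univ
      ((supMinDensity_le_one hμ _ _).trans_lt (ENNReal.one_lt_ofReal.2 h))
    have h2 := one_le_of_supMinDensity_univ_le hμ h1.le
    exact absurd h2 (not_le.2 (ENNReal.ofReal_lt_one.2 hγ1))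
  have hlogl : 0 ≤ Real.log (1 / l) := Real.log_nonneg (by rwa [one_le_div hl])
  have hnull : ∀ E : Set X, μ E = 0 → μ (F ⁻¹' E) = 0 :=
    preimage_null_of_supMinDensity_le hμ hc hF hγ.le hγ1 fun E hE h0 =>
      (hT E univ hE.nullMeasurableSet nullMeasurableSet_univ
        (by rw [h0]; exact ENNReal.ofReal_pos.2 hl)).le
  rw [mul_assoc]
  refine isBMOMap_of_supMinDensity_preimage_le hμ hF hnull hC₂ (by positivity) (hS X μ hμ)
    fun f N t hf hN hfN => (hT _ _ (hf.nullMeasurable measurableSet_Iic)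
      (hf.nullMeasurable measurableSet_Ici) ((hJN X μ hμ f N hf hN hfN t _
        (by positivity)).trans_lt ?_)).le
  rw [ENNReal.ofReal_lt_ofReal_iff hl]
  have h1 : a * (B * (1 + Real.log (1 / l)) * N) / N =
      (1 + Real.log C₁) * (1 + Real.log (1 / l)) := by
    simp only [B]; field_simp
  rw [h1]
  calc C₁ * Real.exp (-((1 + Real.log C₁) * (1 + Real.log (1 / l))))
      < C₁ * Real.exp (-Real.log C₁ + Real.log l) := by
        refine mul_lt_mul_of_pos_left (Real.exp_lt_exp.2 ?_) (by linarith)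
        rw [one_div, Real.log_inv] at hlogl ⊢
        nlinarith
    _ = l := by
        rw [Real.exp_add, Real.exp_neg, Real.exp_log (by linarith), Real.exp_log hl,
          mul_inv_cancel_left₀ (by linarith)]

theorem exists_powerEstimate_of_isBMOMap (hc : 1 < c) : ∃ K β : ℝ, 0 < K ∧ 0 < β ∧
    ∀ (X : Type u) [MetricSpace X] [MeasurableSpace X] [BorelSpace X] (μ : Measure X),
      IsDoublingMeasure c μ → ∀ F : X → X, NullMeasurable F μ → IsBMOMap μ F →
        compOpNorm μ F < ∞ ∧ ∀ α : ℝ, 0 < α →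
          ENNReal.ofReal α * compOpNorm μ F ≤ ENNReal.ofReal β → PowerEstimate μ F K α := by
  obtain ⟨C₁, a, hC₁, ha, hJN⟩ := exists_supMinDensity_level_le.{u} hc
  obtain ⟨C₃, hC₃, hsep⟩ := exists_memBMO_separating.{u} hc
  refine ⟨C₁, a / C₃, by linarith, by positivity, ?_⟩
  intro X _ _ _ μ hμ F hF hBMO
  have := hμ.secondCountableTopology
  have hfin := hBMO.compOpNorm_lt_top hμ hc
  refine ⟨hfin, fun α hα hαβ E₁ E₂ hE₁ hE₂ => ?_⟩
  have hle1 := supMinDensity_le_one hμ E₁ E₂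
  have hne : supMinDensity μ E₁ E₂ ≠ ∞ := ne_top_of_le_ne_top ENNReal.one_ne_top hle1
  rcases hle1.eq_or_lt with h1 | h1
  · rw [h1, ENNReal.one_rpow, mul_one]
    refine (supMinDensity_le_one hμ _ _).trans ?_
    rw [← ENNReal.ofReal_one]
    exact ENNReal.ofReal_le_ofReal hC₁
  set s := (supMinDensity μ E₁ E₂).toReal
  have hs0 : 0 ≤ s := ENNReal.toReal_nonneg
  have hs1 : s < 1 := by
    rw [← ENNReal.toReal_one]
    exact (ENNReal.toReal_lt_toReal hne ENNReal.one_ne_top).2 h1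
  have hs : supMinDensity μ E₁ E₂ = ENNReal.ofReal s := (ENNReal.ofReal_toReal hne).symm
  have key : ∀ σ : ℝ, s < σ → σ < 1 →
      supMinDensity μ (F ⁻¹' E₁) (F ⁻¹' E₂) ≤ ENNReal.ofReal (C₁ * σ ^ α) := by
    intro σ hsσ hσ1
    have hσ : 0 < σ := hs0.trans_lt hsσ
    have hlog : 0 < Real.log (1 / σ) := Real.log_pos (by rwa [one_lt_div hσ])
    obtain ⟨f, hf, hfC, hf1, hf2⟩ := hsep X μ hμ E₁ E₂ σ hE₁ hE₂ hσ hσ1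
      (hs.trans_le (ENNReal.ofReal_le_ofReal hsσ.le))
    have hN : bmoNorm μ (f ∘ F) ≤ ENNReal.ofReal (a / (α * Real.log (1 / σ))) := by
      have h2 : compOpNorm μ F ≤ ENNReal.ofReal (a / C₃ / α) := by
        rw [ENNReal.ofReal_div_of_pos hα, ENNReal.le_div_iff_mul_le (Or.inl (by simpa using hα))
          (Or.inl (by simp)), mul_comm]
        exact hαβ
      refine (bmoNorm_comp_le hfin hf).trans ((mul_le_mul' h2 hfC).trans_eq ?_)
      rw [← ENNReal.ofReal_mul (by positivity)]
      congr 1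
      field_simp
    have hm : AEMeasurable (f ∘ F) μ := aemeasurable_comp_of_preimage_null hF hBMO.preimage_null
      hf.1.aestronglyMeasurable.aemeasurable
    have h2 := hJN X μ hμ (f ∘ F) _ hm (by positivity) hN 0 1 one_pos
    have h3 : Real.exp (-(a * 1 / (a / (α * Real.log (1 / σ))))) = σ ^ α := by
      rw [Real.rpow_def_of_pos hσ, one_div, Real.log_inv]
      congr 1
      rw [one_div, Real.log_inv] at hlog
      have : Real.log σ ≠ 0 := by linarith
      field_simp
    rw [h3] at h2
    refine (supMinDensity_mono_ae ?_ ?_).trans h2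
    · exact ae_comp_of_preimage_null hBMO.preimage_null hf1
    · filter_upwards [ae_comp_of_preimage_null hBMO.preimage_null hf2] with x hx hxE
      show (0 : ℝ) + 1 ≤ f (F x)
      rw [zero_add]
      exact hx hxE
  have hT : Tendsto (fun σ : ℝ => ENNReal.ofReal (C₁ * σ ^ α)) (𝓝[>] s)
      (𝓝 (ENNReal.ofReal (C₁ * s ^ α))) :=
    (ENNReal.tendsto_ofReal ((Real.continuousAt_rpow_const s α (Or.inr hα.le)).tendsto.const_mul
      C₁)).mono_left nhdsWithin_le_nhds
  rw [hs, ENNReal.ofReal_rpow_of_nonneg hs0 hα.le, ← ENNReal.ofReal_mul (by linarith)]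
  refine ge_of_tendsto hT ?_
  filter_upwards [Ioo_mem_nhdsGT hs1] with σ hσ using key σ hσ.1 hσ.2

end Composition

theorem theorem3p1 (c : ℝ) (hc : 1 < c) :
    -- the three conditions are equivalent
    (∀ (X : Type u) [MetricSpace X] [CompleteSpace X] [MeasurableSpace X] [BorelSpace X]
      (μ : Measure X), IsDoublingMeasure c μ → ∀ F : X → X, NullMeasurable F μ →
        [ ∃ K α : ℝ, 0 < K ∧ 0 < α ∧ PowerEstimate μ F K α,
          ∃ γ l : ℝ, 0 < γ ∧ γ < 1 / (4 * c ^ 3) ∧ 0 < l ∧ ThresholdEstimate μ F γ l,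
          IsBMOMap μ F ].TFAE) ∧
    -- the norm bound under the power-type estimate; `C` depends only on `c`
    (∃ C : ℝ, 0 < C ∧
      ∀ (X : Type u) [MetricSpace X] [CompleteSpace X] [MeasurableSpace X] [BorelSpace X]
        (μ : Measure X), IsDoublingMeasure c μ → ∀ F : X → X, NullMeasurable F μ →
          ∀ K α : ℝ, 0 < K → 0 < α → PowerEstimate μ F K α →
            IsBMOMap μ F ∧ compOpNorm μ F ≤ ENNReal.ofReal (C * K / α)) ∧
    -- the norm bound under the threshold estimate; `C` depends only on `c` and `γ`
    (∀ γ : ℝ, 0 < γ → γ < 1 / (4 * c ^ 3) → ∃ C : ℝ, 0 < C ∧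
      ∀ (X : Type u) [MetricSpace X] [CompleteSpace X] [MeasurableSpace X] [BorelSpace X]
        (μ : Measure X), IsDoublingMeasure c μ → ∀ F : X → X, NullMeasurable F μ →
          ∀ l : ℝ, 0 < l → ThresholdEstimate μ F γ l →
            IsBMOMap μ F ∧ compOpNorm μ F ≤ ENNReal.ofReal (C * (1 + Real.log (1 / l)))) ∧
    -- a BMO-map has finite norm and satisfies the power-type estimate with `α = β / ‖C_F‖`
    -- (any `α > 0` if the norm is `0`); `K` and `β` depend only on `c`
    (∃ K β : ℝ, 0 < K ∧ 0 < β ∧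
      ∀ (X : Type u) [MetricSpace X] [CompleteSpace X] [MeasurableSpace X] [BorelSpace X]
        (μ : Measure X), IsDoublingMeasure c μ → ∀ F : X → X, NullMeasurable F μ →
          IsBMOMap μ F → compOpNorm μ F < ∞ ∧
            ∀ α : ℝ, 0 < α → ENNReal.ofReal α * compOpNorm μ F ≤ ENNReal.ofReal β →
              PowerEstimate μ F K α) := by
  refine ⟨?_, ?_, ?_, ?_⟩
  · intro X _ _ _ _ μ hμ F hF
    tfae_have 1 → 3 := by
      rintro ⟨K, α, hK, hα, h⟩
      obtain ⟨C, -, hC⟩ := exists_compOpNorm_le_of_powerEstimate.{u} hc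
      exact (hC X μ hμ F hF K α hK hα h).1
    tfae_have 2 → 3 := by
      rintro ⟨γ, l, hγ, hγc, hl, h⟩
      obtain ⟨C, -, hC⟩ := exists_compOpNorm_le_of_thresholdEstimate.{u} hc hγ hγc
      exact (hC X μ hμ F hF l hl h).1
    tfae_have 3 → 1 := by
      intro h
      obtain ⟨K, β, hK, hβ, hKβ⟩ := exists_powerEstimate_of_isBMOMap.{u} hc
      obtain ⟨hfin, hP⟩ := hKβ X μ hμ F hF h
      obtain ⟨N, hN0, hN⟩ : ∃ N : ℝ, 0 ≤ N ∧ compOpNorm μ F = ENNReal.ofReal N :=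
        ⟨_, ENNReal.toReal_nonneg, (ENNReal.ofReal_toReal hfin.ne).symm⟩
      have hα : 0 < β / (N + 1) := by positivity
      refine ⟨K, β / (N + 1), hK, hα, hP _ hα ?_⟩
      rw [hN, ← ENNReal.ofReal_mul hα.le]
      refine ENNReal.ofReal_le_ofReal ?_
      rw [div_mul_eq_mul_div, div_le_iff₀ (by positivity)]
      nlinarith
    tfae_have 1 → 2 := by
      rintro ⟨K, α, hK, hα, h⟩
      have hγ : 0 < 1 / (8 * c ^ 3) := by positivity
      have hl : 0 < (1 / (8 * c ^ 3) / (2 * K)) ^ (1 / α) := by positivity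
      refine ⟨1 / (8 * c ^ 3), (1 / (8 * c ^ 3) / (2 * K)) ^ (1 / α), hγ,
        one_div_lt_one_div_of_lt (by positivity) (by linarith [pow_pos (one_pos.trans hc) 3]), hl,
        fun E₁ E₂ hE₁ hE₂ hlt => ?_⟩
      refine (h E₁ E₂ hE₁ hE₂).trans_lt
        ((mul_le_mul_right (ENNReal.rpow_le_rpow hlt.le hα.le) _).trans_lt ?_)
      rw [ENNReal.ofReal_rpow_of_pos hl, ← ENNReal.ofReal_mul hK.le,
        ← Real.rpow_mul (by positivity), one_div_mul_cancel hα.ne', Real.rpow_one,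
        ENNReal.ofReal_lt_ofReal_iff hγ,
        show K * (1 / (8 * c ^ 3) / (2 * K)) = 1 / (8 * c ^ 3) / 2 by field_simp]
      linarith
    tfae_finish
  · obtain ⟨C, hC, h⟩ := exists_compOpNorm_le_of_powerEstimate.{u} hc
    exact ⟨C, hC, fun X _ _ _ _ μ hμ F hF K α hK hα hP => h X μ hμ F hF K α hK hα hP⟩
  · intro γ hγ hγc
    obtain ⟨C, hC, h⟩ := exists_compOpNorm_le_of_thresholdEstimate.{u} hc hγ hγc
    exact ⟨C, hC, fun X _ _ _ _ μ hμ F hF l hl hT => h X μ hμ F hF l hl hT⟩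
  · obtain ⟨K, β, hK, hβ, h⟩ := exists_powerEstimate_of_isBMOMap.{u} hc
    exact ⟨K, β, hK, hβ, fun X _ _ _ _ μ hμ F hF hB => h X μ hμ F hF hB⟩
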